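/- Let $\epsilon_0,\mu_0,\epsilon_r>0$, $c=(\epsilon_0\mu_0)^{-1/2}$, let $p:\mathbb R\to\mathbb R$ be the inverse of $q(e)=\epsilon_0(e+\epsilon_r e^3)$, and let $E=\mathbf P(D)=D/(\epsilon_0(1+\epsilon_r p(|D|)^2))$, so $|E|=p(|D|)$. Consider the full Kerr system $$\partial_t D-\operatorname{curl}H=0,\qquad \partial_t H+\mu_0^{-1}\operatorname{curl}\mathbf P(D)=0\qquad (D,H\in\mathbb R^3)$$ and its Transverse Magnetic (TM) reduction for $D=(D_1,D_2,0)$, $H=(0,0,H_3)$ depending on $(t,x_1,x_2)$, $$\partial_tD_1-\partial_2H_3=0,\quad \partial_tD_2+\partial_1H_3=0,\quad \partial_tH_3+\mu_0^{-1}(\partial_1\mathbf P_2(D)-\partial_2\mathbf P_1(D))=0,$$ with energy (entropy) $\eta=\tfrac{\epsilon_0}{2}\left(|E|^2+\tfrac{3\epsilon_r}{2}|E|^4\right)+\tfrac{\mu_0}{2}H_3^2$ and flux $Q=H_3(E_2,-E_1)$. For the full system the energy is $\tfrac{\epsilon_0}{2}(|E|^2+\tfrac{3\epsilon_r}{2}|E|^4)+\tfrac{\mu_0}{2}|H|^2$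 with flux $E\times H$. An entropy solution is an $L^\infty$ weak solution of the initial value problem with $\partial_t\eta+\operatorname{div}Q\le 0$ in the weak sense. Let $\omega=e_1$, $d\neq 0$, $h\in\mathbb R$, $u_-=(D_1,D_2,H_3)=(0,d,h)$, $\sigma=c\,(1+\epsilon_r p(|d|)^2)^{-1/2}$, and $u_+=(0,-d,\,h-2\sigma d)$ (so $D_+=-D_-$). Seen as states of the full system, $u_-$ and $u_+$ are distinct and are joined by a contact discontinuity of speed $\sigma$ for the field of its largest eigenvalue $\lambda_6=c(1+\epsilon_r|E|^2)^{-1/2}$ (a $6$-contact). Then the Riemann problem for the TM system with data $u_-$ for $x_1<0$, $u_+$ for $x_1>0$ has two distinct (not almost everywhere equal) self-similar entropy solutions $V(x_1/t)$ and $W(x_1/t)$; moreover, both are, as TM fields, entropy solutions of the full Kerr system. (a) $V=u_-$ for $x_1<\sigma t$ and $V=u_+$ for $x_1>\sigma t$. As a TM field, $V$ is a Lax solution of the Riemann problem for the full system (a superposition of a $1$-contact, a $2$-wave, a stationary contact, a $5$-wave and a $6$-contact, where a $2$- or $5$-wave is trivial, a Lax shock or a rarefaction), and it conserves energy: $\partial_t\eta+\operatorname{div}Q=0$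 in the weak sense. (b) $W$ is a Liu solution of the TM Riemann problem (a superposition of a $1$-wave, a stationary contact and a $3$-wave, where each $1$- or $3$-wave is trivial, a rarefaction, a shock satisfying Liu's condition (E), or a composite of a rarefaction and such a shock whose speed is characteristic on the side of the rarefaction). It consists of a $1$-rarefaction from $u_-$ to a state $u_1$ and a composite $3$-wave: a $3$-rarefaction from $u_1$ to a state $v$ and a Liu-admissible shock from $v$ to $u_+$ of speed $s=\lambda_3(v)$, where $\lambda_3>0$ is the largest eigenvalue of the TM system in the direction $e_1$ and $D_2$ has opposite signs at $v$ and $u_+$. It does not conserve energy; the dissipation is carried by the shock: $$\partial_t\eta+\operatorname{div}Q=m\,\delta_{\{x_1=st\}},\qquad m=-s\,[\eta]+[Q_1]<0,$$ where $[\cdot]$ is the value at $u_+$ minus the value at $v$, and $\delta_{\{x_1=st\}}$ is the distribution $\varphi\mapsto\int_0^\infty\!\int_{\mathbb R}\varphi(t,st,x_2)\,dx_2\,dt$. -/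

import Mathlib

open MeasureTheory Set
open scoped Matrix

noncomputable section

namespace Kerr

/-! ### Conservation laws in `n` space variables: weak and entropy solutions -/

/-- Points of space-time: `(t, x)` with `x ∈ ℝⁿ`. -/
abbrev SpaceTime (n : ℕ) : Type := ℝ × (Fin n → ℝ)

/-- The open half space `t > 0`. -/
def future (n : ℕ) : Set (SpaceTime n) := Ioi (0 : ℝ) ×ˢ univ

/-- Test functions `φ ∈ C_c^∞(ℝ × ℝⁿ)`; they need not vanish at `t = 0`. -/
def IsTest {n : ℕ} (φ : SpaceTime n → ℝ) : Prop :=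
  ContDiff ℝ (⊤ : ℕ∞) φ ∧ HasCompactSupport φ

/-- `∂_t φ`. -/
def dt {n : ℕ} (φ : SpaceTime n → ℝ) (z : SpaceTime n) : ℝ := fderiv ℝ φ z (1, 0)

/-- `∂_j φ`. -/
def dx {n : ℕ} (j : Fin n) (φ : SpaceTime n → ℝ) (z : SpaceTime n) : ℝ :=
  fderiv ℝ φ z (0, Pi.single j 1)

/-- `∫_{t > 0} (w ∂_t φ + ∑_j G_j ∂_j φ) dt dx + ∫ w₀(x) φ(0, x) dx`, that is, minus the pairing
of `∂_t w + div G` (with `w = w₀` at `t = 0`) with `φ`. -/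
def weakForm {n : ℕ} {X : Type*} [NormedAddCommGroup X] [NormedSpace ℝ X]
    (w : SpaceTime n → X) (G : Fin n → SpaceTime n → X) (w₀ : (Fin n → ℝ) → X)
    (φ : SpaceTime n → ℝ) : X :=
  (∫ z in future n, (dt φ z • w z + ∑ j, dx j φ z • G j z)) + ∫ x, φ (0, x) • w₀ x

/-- `u ∈ L^∞` is a weak solution of `∂_t u + ∑_j ∂_j F_j(u) = 0`, `u(0, ·) = u₀`. -/
def IsWeakSolution {n : ℕ} {X : Type*} [NormedAddCommGroup X] [NormedSpace ℝ X]
    (F : Fin n → X → X) (u₀ : (Fin n → ℝ) → X) (u : SpaceTime n → X) : Prop :=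
  MemLp u ⊤ (volume.restrict (future n)) ∧
    ∀ φ, IsTest φ → weakForm u (fun j z => F j (u z)) u₀ φ = 0

/-- The weak formulation of `∂_t η(u) + div Q(u)`, with initial value `η(u₀)`. -/
def entropyForm {n : ℕ} {X : Type*} (η : X → ℝ) (Q : Fin n → X → ℝ)
    (u₀ : (Fin n → ℝ) → X) (u : SpaceTime n → X) (φ : SpaceTime n → ℝ) : ℝ :=
  weakForm (fun z => η (u z)) (fun j z => Q j (u z)) (fun x => η (u₀ x)) φ

/-- A weak solution with `∂_t η(u) + div Q(u) ≤ 0` in the weak sense. -/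
def IsEntropySolution {n : ℕ} {X : Type*} [NormedAddCommGroup X] [NormedSpace ℝ X]
    (F : Fin n → X → X) (η : X → ℝ) (Q : Fin n → X → ℝ)
    (u₀ : (Fin n → ℝ) → X) (u : SpaceTime n → X) : Prop :=
  IsWeakSolution F u₀ u ∧
    ∀ φ, IsTest φ → (∀ z, 0 ≤ φ z) → 0 ≤ entropyForm η Q u₀ u φ

/-- `∂_t η(u) + div Q(u) = 0` in the weak sense. -/
def ConservesEntropy {n : ℕ} {X : Type*} (η : X → ℝ) (Q : Fin n → X → ℝ)
    (u₀ : (Fin n → ℝ) → X) (u : SpaceTime n → X) : Prop :=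
  ∀ φ, IsTest φ → entropyForm η Q u₀ u φ = 0

/-- Riemann data in the direction `ω`. -/
def riemannData {n : ℕ} {X : Type*} (ω : Fin n → ℝ) (ul ur : X) (x : Fin n → ℝ) : X :=
  if ω ⬝ᵥ x < 0 then ul else ur

/-- The self-similar function `u(t, x) = V(x · ω / t)`. -/
def selfSimilar {n : ℕ} {X : Type*} (ω : Fin n → ℝ) (V : ℝ → X) (z : SpaceTime n) : X :=
  V ((ω ⬝ᵥ z.2) / z.1)

/-- The flux (or entropy flux) in the direction `ω`. -/
def dirFlux {n : ℕ} {X Y : Type*} [AddCommGroup Y] [Module ℝ Y] (F : Fin n → X → Y)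
    (ω : Fin n → ℝ) (u : X) : Y := ∑ j, ω j • F j u

/-! ### Elementary waves of a one-dimensional system with flux `F`

`V` is a profile, a function of `ξ = y / t`; `lam` is a characteristic speed. -/

/-- Rankine-Hugoniot conditions `σ [u] = [F(u)]`. -/
def RankineHugoniot {X : Type*} [AddCommGroup X] [Module ℝ X] (F : X → X) (σ : ℝ)
    (ul ur : X) : Prop := σ • (ur - ul) = F ur - F ul

/-- A (possibly trivial) contact discontinuity for the field with speed `lam`. -/
def IsContact {X : Type*} [AddCommGroup X] [Module ℝ X] (F : X → X) (lam : X → ℝ) (σ : ℝ)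
    (ul ur : X) : Prop := RankineHugoniot F σ ul ur ∧ lam ul = σ ∧ lam ur = σ

/-- On `[a, b]` the profile `V` is a centred rarefaction wave from `ul` to `ur` for the field with
speed `lam`: `lam (V ξ) = ξ` and `F(V)' = ξ V'`, i.e. `V'` is an eigenvector for `ξ`. -/
structure IsRarefaction {X : Type*} [NormedAddCommGroup X] [NormedSpace ℝ X] (F : X → X)
    (lam : X → ℝ) (V : ℝ → X) (a b : ℝ) (ul ur : X) : Prop where
  lt : a < b
  continuousOn : ContinuousOn V (Icc a b)
  left : V a = ul
  right : V b = ur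
  speed : ∀ ξ ∈ Icc a b, lam (V ξ) = ξ
  ode : ∀ ξ ∈ Ioo a b, ∃ V' : X,
    HasDerivAt V V' ξ ∧ HasDerivAt (fun s => F (V s)) (ξ • V') ξ

/-- The left-hand side `-σ [η] + [Q]` of the entropy inequality at a discontinuity. -/
def entropyJump {X : Type*} (η Q : X → ℝ) (σ : ℝ) (ul ur : X) : ℝ :=
  -σ * (η ur - η ul) + (Q ur - Q ul)

/-! ### The Kerr medium -/

/-- Euclidean length of a vector. -/
def eLen {n : ℕ} (v : Fin n → ℝ) : ℝ := √(v ⬝ᵥ v)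

/-- The physical constants. -/
structure Medium where
  ε₀ : ℝ
  μ₀ : ℝ
  εr : ℝ
  ε₀_pos : 0 < ε₀
  μ₀_pos : 0 < μ₀
  εr_pos : 0 < εr

namespace Medium

/-- The speed of light. -/
def c (M : Medium) : ℝ := (√(M.ε₀ * M.μ₀))⁻¹

/-- `q(e) = ε₀ (e + εr e³)`. -/
def q (M : Medium) (e : ℝ) : ℝ := M.ε₀ * (e + M.εr * e ^ 3)

theorem q_bijective (M : Medium) : Function.Bijective M.q := by
  have h0 := M.ε₀_pos
  have h1 := M.εr_pos
  have hm : StrictMono M.q := by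
    intro x y hxy
    have h3 : x ^ 3 < y ^ 3 := (Odd.strictMono_pow (by decide)) hxy
    have h4 : M.εr * x ^ 3 < M.εr * y ^ 3 := mul_lt_mul_of_pos_left h3 h1
    exact mul_lt_mul_of_pos_left (add_lt_add hxy h4) h0
  have hc : Continuous M.q := by unfold q; fun_prop
  refine ⟨hm.injective, fun y => ?_⟩
  have hlo : M.q (-(|y| / M.ε₀)) ≤ y := by
    have hn : 0 ≤ |y| / M.ε₀ := by positivity
    have hy : M.ε₀ * (|y| / M.ε₀) = |y| := by field_simp
    have hpos : 0 ≤ M.ε₀ * (M.εr * (|y| / M.ε₀) ^ 3) := by positivity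
    have : M.q (-(|y| / M.ε₀)) = -(M.ε₀ * (|y| / M.ε₀)) - M.ε₀ * (M.εr * (|y| / M.ε₀) ^ 3) := by
      unfold q; ring
    rw [this, hy]
    linarith [neg_abs_le y]
  have hhi : y ≤ M.q (|y| / M.ε₀) := by
    have hn : 0 ≤ |y| / M.ε₀ := by positivity
    have hy : M.ε₀ * (|y| / M.ε₀) = |y| := by field_simp
    have hpos : 0 ≤ M.ε₀ * (M.εr * (|y| / M.ε₀) ^ 3) := by positivity
    have : M.q (|y| / M.ε₀) = M.ε₀ * (|y| / M.ε₀) + M.ε₀ * (M.εr * (|y| / M.ε₀) ^ 3) := by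
      unfold q; ring
    rw [this, hy]
    linarith [le_abs_self y]
  exact mem_range_of_exists_le_of_exists_ge hc ⟨_, hlo⟩ ⟨_, hhi⟩

/-- `p = q⁻¹`. -/
def p (M : Medium) : ℝ → ℝ := (Equiv.ofBijective M.q M.q_bijective).symm

/-- The electric field `E = P(D) = D / (ε₀ (1 + εr p(|D|)²))`. -/
def eField (M : Medium) {n : ℕ} (D : Fin n → ℝ) : Fin n → ℝ :=
  (M.ε₀ * (1 + M.εr * M.p (eLen D) ^ 2))⁻¹ • D

/-- The electric part of the energy density, `ε₀/2 (|E|² + (3 εr / 2) |E|⁴)`; its gradient with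
respect to `D` is `E`. -/
def electricEnergy (M : Medium) {n : ℕ} (D : Fin n → ℝ) : ℝ :=
  M.ε₀ / 2 * (eLen (M.eField D) ^ 2 + 3 * M.εr / 2 * eLen (M.eField D) ^ 4)

/-- `c / √(1 + εr |E|²)`, the largest eigenvalue of the full system. -/
def lamMax (M : Medium) {n : ℕ} (D : Fin n → ℝ) : ℝ :=
  M.c / √(1 + M.εr * eLen (M.eField D) ^ 2)

/-- The eigenvalue `λ > 0` (in the direction `ω`) common to the full system and the TM system. -/
def lam (M : Medium) {n : ℕ} (ω D : Fin n → ℝ) : ℝ :=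
  M.c * √((1 + M.εr * (eLen (M.eField D) ^ 2 + 2 * (M.eField D ⬝ᵥ ω) ^ 2)) /
    ((1 + M.εr * eLen (M.eField D) ^ 2) * (1 + 3 * M.εr * eLen (M.eField D) ^ 2)))

end Medium

/-! ### The full `6 × 6` Kerr system `∂_t D - curl H = 0`, `∂_t H + μ₀⁻¹ curl P(D) = 0` -/

/-- States `(D, H)`. -/
abbrev FullState : Type := (Fin 3 → ℝ) × (Fin 3 → ℝ)

/-- Fluxes of the full system: `curl H = ∑_j e_j × ∂_j H`. -/
def fullFlux (M : Medium) (j : Fin 3) (u : FullState) : FullState :=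
  (-(crossProduct (Pi.single j (1 : ℝ)) u.2),
    M.μ₀⁻¹ • crossProduct (Pi.single j (1 : ℝ)) (M.eField u.1))

/-- Electromagnetic energy density. -/
def fullEnergy (M : Medium) (u : FullState) : ℝ :=
  M.electricEnergy u.1 + M.μ₀ / 2 * eLen u.2 ^ 2

/-- Poynting vector `E × H`. -/
def fullEnergyFlux (M : Medium) (j : Fin 3) (u : FullState) : ℝ :=
  crossProduct (M.eField u.1) u.2 j

/-- The eigenvalues `λ₁ ≤ λ₂ < λ₃ = λ₄ = 0 < λ₅ ≤ λ₆` in the direction `ω`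
(only `1 ≤ k ≤ 6` is meaningful). -/
def fullEig (M : Medium) (ω : Fin 3 → ℝ) (k : ℕ) (u : FullState) : ℝ :=
  match k with
  | 1 => -M.lamMax u.1
  | 2 => -M.lam ω u.1
  | 5 => M.lam ω u.1
  | 6 => M.lamMax u.1
  | _ => 0

/-- Contact discontinuity of the full system associated to the field `k`. -/
def IsFullContact (M : Medium) (ω : Fin 3 → ℝ) (k : ℕ) (σ : ℝ) (ul ur : FullState) : Prop :=
  IsContact (dirFlux (fullFlux M) ω) (fullEig M ω k) σ ul ur

/-- Lax `k`-shock of the full system (`k = 2, 5`); shocks are the discontinuities that are not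
contact discontinuities, hence the condition `|E_-| ≠ |E_+|`. -/
def IsLaxShock (M : Medium) (ω : Fin 3 → ℝ) (k : ℕ) (σ : ℝ) (ul ur : FullState) : Prop :=
  RankineHugoniot (dirFlux (fullFlux M) ω) σ ul ur ∧
    eLen (M.eField ul.1) ≠ eLen (M.eField ur.1) ∧
    fullEig M ω k ur ≤ σ ∧ σ ≤ fullEig M ω (k + 1) ur ∧
    fullEig M ω (k - 1) ul ≤ σ ∧ σ ≤ fullEig M ω k ul

/-- On `[a, b]` the profile `V` is a `k`-wave (`k = 2, 5`) of the full system from `ul` to `ur`: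
trivial, a Lax shock or a rarefaction. -/
def IsLaxWave (M : Medium) (ω : Fin 3 → ℝ) (k : ℕ) (V : ℝ → FullState) (a b : ℝ)
    (ul ur : FullState) : Prop :=
  (a = b ∧ ul = ur) ∨ (a = b ∧ IsLaxShock M ω k a ul ur) ∨
    IsRarefaction (dirFlux (fullFlux M) ω) (fullEig M ω k) V a b ul ur

/-- `V` is the profile of a Lax solution of the Riemann problem for the full system: a
superposition of a `1`-contact, a `2`-wave, a stationary contact, a `5`-wave, a `6`-contact. -/
def IsLaxSolution (M : Medium) (ω : Fin 3 → ℝ) (ul ur : FullState) (V : ℝ → FullState) : Prop :=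
  ∃ (u₁ v₁ v₂ u₂ : FullState) (s₁ a₂ b₂ a₅ b₅ s₆ : ℝ),
    s₁ ≤ a₂ ∧ a₂ ≤ b₂ ∧ b₂ ≤ 0 ∧ 0 ≤ a₅ ∧ a₅ ≤ b₅ ∧ b₅ ≤ s₆ ∧
    (∀ ξ < s₁, V ξ = ul) ∧
    IsFullContact M ω 1 s₁ ul u₁ ∧
    (∀ ξ ∈ Ioo s₁ a₂, V ξ = u₁) ∧
    IsLaxWave M ω 2 V a₂ b₂ u₁ v₁ ∧
    (∀ ξ ∈ Ioo b₂ 0, V ξ = v₁) ∧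
    IsFullContact M ω 3 0 v₁ v₂ ∧
    (∀ ξ ∈ Ioo 0 a₅, V ξ = v₂) ∧
    IsLaxWave M ω 5 V a₅ b₅ v₂ u₂ ∧
    (∀ ξ ∈ Ioo b₅ s₆, V ξ = u₂) ∧
    IsFullContact M ω 6 s₆ u₂ ur ∧
    (∀ ξ, s₆ < ξ → V ξ = ur)

/-! ### The `3 × 3` Transverse Magnetic system in two space variables -/

/-- States `((D₁, D₂), H₃)`. -/
abbrev TMState : Type := (Fin 2 → ℝ) × ℝ

/-- The system `∂_t D₁ - ∂₂ H₃ = 0`, `∂_t D₂ + ∂₁ H₃ = 0`,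
`∂_t H₃ + μ₀⁻¹ (∂₁ P₂(D) - ∂₂ P₁(D)) = 0`. -/
def tmFlux (M : Medium) (j : Fin 2) (u : TMState) : TMState :=
  match j with
  | 0 => (![0, u.2], M.μ₀⁻¹ * M.eField u.1 1)
  | 1 => (![-u.2, 0], -(M.μ₀⁻¹ * M.eField u.1 0))

/-- Electromagnetic energy density of a TM state. -/
def tmEnergy (M : Medium) (u : TMState) : ℝ := M.electricEnergy u.1 + M.μ₀ / 2 * u.2 ^ 2

/-- Energy flux `H₃ (E₂, -E₁)`. -/
def tmEnergyFlux (M : Medium) (j : Fin 2) (u : TMState) : ℝ :=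
  match j with
  | 0 => u.2 * M.eField u.1 1
  | 1 => -(u.2 * M.eField u.1 0)

/-- The eigenvalues `-λ < 0 < λ` of the TM system (only `1 ≤ k ≤ 3` is meaningful). -/
def tmEig (M : Medium) (ω : Fin 2 → ℝ) (k : ℕ) (u : TMState) : ℝ :=
  match k with
  | 1 => -M.lam ω u.1
  | 3 => M.lam ω u.1
  | _ => 0

/-- `ω × D = ω₁ D₂ - ω₂ D₁`. -/
def cross2 (ω D : Fin 2 → ℝ) : ℝ := ω 0 * D 1 - ω 1 * D 0

/-- A discontinuity satisfying the Rankine-Hugoniot conditions and Liu's condition (E):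
`σ(ur, ul) ≤ σ(u, ul)` for every `u` between `ul` and `ur` on the same branch (sign of the speed)
of the Hugoniot set of `ul`. -/
def IsLiuAdmissible (M : Medium) (ω : Fin 2 → ℝ) (σ : ℝ) (ul ur : TMState) : Prop :=
  RankineHugoniot (dirFlux (tmFlux M) ω) σ ul ur ∧
    ∀ (u : TMState) (τ : ℝ), RankineHugoniot (dirFlux (tmFlux M) ω) τ ul u → 0 < σ * τ →
      (∃ θ ∈ Ioc (0 : ℝ) 1, u.1 = ul.1 + θ • (ur.1 - ul.1)) → σ ≤ τ

/-- Liu `1`-shock (negative speed) from `ul` to `ur`. -/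
def IsLiuShock₁ (M : Medium) (ω : Fin 2 → ℝ) (σ : ℝ) (ul ur : TMState) : Prop :=
  σ < 0 ∧ ul ≠ ur ∧ IsLiuAdmissible M ω σ ul ur

/-- Liu `3`-shock (positive speed) from `ul` to `ur`. -/
def IsLiuShock₃ (M : Medium) (ω : Fin 2 → ℝ) (σ : ℝ) (ul ur : TMState) : Prop :=
  0 < σ ∧ ul ≠ ur ∧ IsLiuAdmissible M ω σ ul ur

/-- On `[a, b]` the profile `V` is a composite `1`-wave: the Liu shock of speed `a` from `ul` to
`v = u_*(ul)`, on the other side of `ω × D = 0` and characterized by `λ₁(v) = a` (which is part of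
`IsRarefaction`), followed by a rarefaction from `v` to `ur`. -/
def IsComposite₁ (M : Medium) (ω : Fin 2 → ℝ) (V : ℝ → TMState) (a b : ℝ)
    (ul v ur : TMState) : Prop :=
  IsLiuShock₁ M ω a ul v ∧ cross2 ω ul.1 * cross2 ω v.1 < 0 ∧
    IsRarefaction (dirFlux (tmFlux M) ω) (tmEig M ω 1) V a b v ur

/-- On `[a, b]` the profile `V` is a composite `3`-wave: a rarefaction from `ul` to `v = u_*(ur)`,
on the other side of `ω × D = 0` and with `λ₃(v) = b`, followed by the Liu shock of speed `b` from
`v` to `ur`. -/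
def IsComposite₃ (M : Medium) (ω : Fin 2 → ℝ) (V : ℝ → TMState) (a b : ℝ)
    (ul v ur : TMState) : Prop :=
  IsRarefaction (dirFlux (tmFlux M) ω) (tmEig M ω 3) V a b ul v ∧
    cross2 ω v.1 * cross2 ω ur.1 < 0 ∧ IsLiuShock₃ M ω b v ur

/-- `1`-waves of the TM system. -/
def IsLiuWave₁ (M : Medium) (ω : Fin 2 → ℝ) (V : ℝ → TMState) (a b : ℝ)
    (ul ur : TMState) : Prop :=
  (a = b ∧ ul = ur) ∨ (a = b ∧ IsLiuShock₁ M ω a ul ur) ∨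
    IsRarefaction (dirFlux (tmFlux M) ω) (tmEig M ω 1) V a b ul ur ∨
    ∃ v, IsComposite₁ M ω V a b ul v ur

/-- `3`-waves of the TM system. -/
def IsLiuWave₃ (M : Medium) (ω : Fin 2 → ℝ) (V : ℝ → TMState) (a b : ℝ)
    (ul ur : TMState) : Prop :=
  (a = b ∧ ul = ur) ∨ (a = b ∧ IsLiuShock₃ M ω a ul ur) ∨
    IsRarefaction (dirFlux (tmFlux M) ω) (tmEig M ω 3) V a b ul ur ∨
    ∃ v, IsComposite₃ M ω V a b ul v ur

/-- `V` is the profile of a Liu solution of the Riemann problem for the TM system: a superposition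
of a `1`-wave, a stationary contact and a `3`-wave. -/
def IsLiuSolution (M : Medium) (ω : Fin 2 → ℝ) (ul ur : TMState) (V : ℝ → TMState) : Prop :=
  ∃ (u₁ u₂ : TMState) (a₁ b₁ a₃ b₃ : ℝ),
    a₁ ≤ b₁ ∧ b₁ ≤ 0 ∧ 0 ≤ a₃ ∧ a₃ ≤ b₃ ∧
    (∀ ξ < a₁, V ξ = ul) ∧
    IsLiuWave₁ M ω V a₁ b₁ ul u₁ ∧
    (∀ ξ ∈ Ioo b₁ 0, V ξ = u₁) ∧
    IsContact (dirFlux (tmFlux M) ω) (tmEig M ω 2) 0 u₁ u₂ ∧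
    (∀ ξ ∈ Ioo 0 a₃, V ξ = u₂) ∧
    IsLiuWave₃ M ω V a₃ b₃ u₂ ur ∧
    (∀ ξ, b₃ < ξ → V ξ = ur)

/-- The full state `((D₁, D₂, 0), (0, 0, H₃))` of a TM state. -/
def toFull (u : TMState) : FullState := (![u.1 0, u.1 1, 0], ![0, 0, u.2])

end Kerr

end

noncomputable section

namespace Kerr

/-! ### Self-similar weak solutions as superpositions of step functions -/

/-! For fields with `E = (0, e)` and `H` depending on `(t, x₁)` only, both systems reduce to `∂_t
q(e) + ∂₁ H = 0`, `∂_t H + μ₀⁻¹ ∂₁ e = 0`, where `q` is an odd cubic with an inflection at `e = 0`.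
Write `d = q(κ E)` with `κ = ±1`, `E > 0`.

A jump satisfying Rankine-Hugoniot has a speed given by the slope of a chord of `q`, and produces
energy at the rate `-s ε₀ εr / 4 · [e²] [e]²` (`energy_production`). The jump from `κ E` to `-κ E`
keeps `|e|`, so it conserves energy; in the full system its speed is the eigenvalue `λ₆` on both
sides. This is `V`.

For `W`, the chord of `q` from `-E` is tangent to the graph at exactly `E / 2`, since `x² + x y + y²
= 3 x²` for `x = E / 2`, `y = -E`. Hence the shock from `κ E / 2` to `-κ E` is characteristic on the
left; it is Liu-admissible (`isLiuAdmissible_of_half`) and dissipates because `E² > (E / 2)²`. Along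
rarefactions `H ± Φ(e)` is constant, `Φ = ∫ λ dq`, and eliminating `H` leaves one scalar equation
for the middle field `E₁`. The 1-wave is a rarefaction precisely when `E₁ > E`. This is a strict
Jensen inequality for the square root (`phi_sub_phi_half_lt`): on `[-E, E]`, with the arc over `[-E,
E / 2]` replaced by the tangent chord, the slope of `q` has mean `q(E) / E`, which is the slope that
determines the contact speed `σ`.

The weak formulations rest on scalar balances `∂_t A(x₀/t) + ∂₀ B(x₀/t) = m δ`. Constants and jumps
are direct; a rarefaction is a superposition of steps `1_{x₀ > r t}`, each transported at its own
speed `r`. `Balance` is stated in every dimension, so one computation serves the TM and the full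
system, whose transverse fluxes do not depend on the transverse variables. -/

/-- The shear `(t, x) ↦ (t, x + r t e₀)`. -/
def shearCLM (n : ℕ) (r : ℝ) : SpaceTime (n + 1) →L[ℝ] SpaceTime (n + 1) :=
  ContinuousLinearMap.id ℝ _ + (ContinuousLinearMap.inr ℝ ℝ (Fin (n + 1) → ℝ)).comp
    ((ContinuousLinearMap.fst ℝ ℝ (Fin (n + 1) → ℝ)).smulRight (Pi.single 0 r : Fin (n + 1) → ℝ))

theorem shearCLM_apply (n : ℕ) (r : ℝ) (z : SpaceTime (n + 1)) :
    shearCLM n r z = (z.1, z.2 + z.1 • Pi.single 0 r) := by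
  simp [shearCLM, Prod.ext_iff]

theorem shearCLM_shearCLM (n : ℕ) (r : ℝ) (z : SpaceTime (n + 1)) :
    shearCLM n r (shearCLM n (-r) z) = z := by
  simp only [shearCLM_apply, Pi.single_neg]
  ext <;> simp

/-- The shear as a continuous linear equivalence. -/
def shear (n : ℕ) (r : ℝ) : SpaceTime (n + 1) ≃L[ℝ] SpaceTime (n + 1) :=
  ContinuousLinearEquiv.equivOfInverse (shearCLM n r) (shearCLM n (-r))
    (fun z => by simpa using shearCLM_shearCLM n (-r) z) (shearCLM_shearCLM n r)

theorem shear_apply (n : ℕ) (r : ℝ) (z : SpaceTime (n + 1)) :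
    shear n r z = (z.1, z.2 + z.1 • Pi.single 0 r) := shearCLM_apply n r z

/-- For each fixed time the shear is a translation in space, so Fubini gives invariance of Lebesgue
measure. -/
theorem measurePreserving_shear (n : ℕ) (r : ℝ) :
    MeasurePreserving (shear n r) := by
  have h := MeasurePreserving.skew_product (MeasurePreserving.id (volume : Measure ℝ))
    (μc := (volume : Measure (Fin (n + 1) → ℝ))) (μd := (volume : Measure (Fin (n + 1) → ℝ)))
    (g := fun t x => x + t • Pi.single 0 r) (by fun_prop)
    (ae_of_all _ fun t => (measurePreserving_add_right volume (t • Pi.single 0 r)).map_eq)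
  convert h using 1
  · ext1 z
    exact shear_apply n r z
  all_goals exact Measure.volume_eq_prod _ _

theorem setIntegral_future_shear (n : ℕ) (r : ℝ) (f : SpaceTime (n + 1) → ℝ) :
    ∫ z in future (n + 1), f (shear n r z) = ∫ z in future (n + 1), f z := by
  have h := (measurePreserving_shear n r).setIntegral_preimage_emb
    (shear n r).toHomeomorph.measurableEmbedding f (future (n + 1))
  rw [← h]
  congr 2
  ext z
  simp [future, shear_apply]

theorem IsTest.shear {n : ℕ} {φ : SpaceTime (n + 1) → ℝ} (hφ : IsTest φ) (r : ℝ) :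
    IsTest (fun z => φ (shear n r z)) :=
  ⟨hφ.1.comp (Kerr.shear n r).contDiff, hφ.2.comp_homeomorph (Kerr.shear n r).toHomeomorph⟩

theorem IsTest.differentiable {n : ℕ} {φ : SpaceTime n → ℝ} (hφ : IsTest φ) :
    Differentiable ℝ φ := hφ.1.differentiable (by simp)

theorem fderiv_comp_shear {n : ℕ} (φ : SpaceTime (n + 1) → ℝ) (r : ℝ) (z : SpaceTime (n + 1)) :
    fderiv ℝ (fun z => φ (shear n r z)) z = (fderiv ℝ φ (shear n r z)).comp
      (shear n r : SpaceTime (n + 1) →L[ℝ] SpaceTime (n + 1)) :=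
  (shear n r).comp_right_fderiv (f := φ) (x := z)

/-- The transport operator `∂_t + r ∂₀` becomes `∂_t` in sheared coordinates, in which the plane `x₀
= r t` is at rest. -/
theorem dt_comp_shear {n : ℕ} (φ : SpaceTime (n + 1) → ℝ) (r : ℝ) (z : SpaceTime (n + 1)) :
    dt (fun z => φ (shear n r z)) z = dt φ (shear n r z) + r * dx 0 φ (shear n r z) := by
  have h : (shear n r) ((1 : ℝ), (0 : Fin (n + 1) → ℝ))
      = (1, 0) + r • ((0 : ℝ), (Pi.single 0 1 : Fin (n + 1) → ℝ)) := by
    rw [shear_apply]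
    ext i
    · simp
    · by_cases hi : i = 0 <;> simp [hi]
  simp only [dt, dx, fderiv_comp_shear, ContinuousLinearMap.comp_apply,
    ContinuousLinearEquiv.coe_coe, h, map_add, map_smul, smul_eq_mul]

theorem dx_zero_comp_shear {n : ℕ} (φ : SpaceTime (n + 1) → ℝ) (r : ℝ)
    (z : SpaceTime (n + 1)) :
    dx 0 (fun z => φ (shear n r z)) z = dx 0 φ (shear n r z) := by
  have h : (shear n r) ((0 : ℝ), (Pi.single 0 1 : Fin (n + 1) → ℝ)) = (0, Pi.single 0 1) := by
    simp [shear_apply]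
  simp only [dx, fderiv_comp_shear, ContinuousLinearMap.comp_apply,
    ContinuousLinearEquiv.coe_coe, h]

theorem IsTest.continuous_fderiv_apply {n : ℕ} {φ : SpaceTime n → ℝ} (hφ : IsTest φ)
    (v : SpaceTime n) : Continuous (fun z => fderiv ℝ φ z v) :=
  (hφ.1.continuous_fderiv (by simp)).clm_apply continuous_const

theorem IsTest.integrable_fderiv_apply {n : ℕ} {φ : SpaceTime n → ℝ} (hφ : IsTest φ)
    (v : SpaceTime n) : Integrable (fun z => fderiv ℝ φ z v) :=
  (hφ.continuous_fderiv_apply v).integrable_of_hasCompactSupport (hφ.2.fderiv_apply ℝ v)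

theorem IsTest.integrable_dt {n : ℕ} {φ : SpaceTime n → ℝ} (hφ : IsTest φ) :
    Integrable (dt φ) := hφ.integrable_fderiv_apply _

theorem IsTest.integrable_dx {n : ℕ} {φ : SpaceTime n → ℝ} (hφ : IsTest φ) (j : Fin n) :
    Integrable (dx j φ) := hφ.integrable_fderiv_apply _

theorem IsTest.hasCompactSupport_comp {n : ℕ} {φ : SpaceTime n → ℝ} (hφ : IsTest φ)
    {Y : Type*} [TopologicalSpace Y] {f : Y → SpaceTime n} (hf : Topology.IsClosedEmbedding f) :
    HasCompactSupport (fun y => φ (f y)) := hφ.2.comp_isClosedEmbedding hf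

theorem isClosedEmbedding_time_slice {n : ℕ} (t : ℝ) :
    Topology.IsClosedEmbedding (fun x : Fin n → ℝ => ((t, x) : SpaceTime n)) :=
  Topology.IsClosedEmbedding.of_continuous_injective_isClosedMap (by fun_prop)
    (fun x y h => (Prod.ext_iff.1 h).2) (isClosedMap_prodMk_left t)

theorem IsTest.integrable_initial {n : ℕ} {φ : SpaceTime n → ℝ} (hφ : IsTest φ) :
    Integrable (fun x => φ (0, x)) :=
  Continuous.integrable_of_hasCompactSupport (hφ.1.continuous.comp (by fun_prop))
    (hφ.hasCompactSupport_comp (isClosedEmbedding_time_slice 0))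

theorem volume_restrict_future (n : ℕ) : (volume.restrict (future n) : Measure (SpaceTime n)) =
    (volume.restrict (Ioi (0 : ℝ))).prod volume := by
  rw [future, Measure.volume_eq_prod, ← Measure.prod_restrict, Measure.restrict_univ]

/-- Integration in time: `∫_{t > 0} χ(x) ∂_t φ = - ∫ χ(x) φ(0, x)`. -/
theorem IsTest.integral_future_dt {n : ℕ} {φ : SpaceTime n → ℝ} (hφ : IsTest φ)
    {χ : (Fin n → ℝ) → ℝ} (hχ : Measurable χ) (hb : ∀ x, |χ x| ≤ 1) :
    ∫ z in future n, χ z.2 * dt φ z = -∫ x, χ x * φ (0, x) := by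
  have hi : Integrable (fun z => χ z.2 * dt φ z)
      ((volume.restrict (Ioi (0 : ℝ))).prod (volume : Measure (Fin n → ℝ))) := by
    rw [← volume_restrict_future]
    exact (hφ.integrable_dt.integrableOn).bdd_mul (c := 1)
      (hχ.comp measurable_snd).aestronglyMeasurable (ae_of_all _ fun z => hb z.2)
  rw [volume_restrict_future, integral_prod_symm _ hi, ← integral_neg]
  congr 1
  ext x
  have hc : ContDiff ℝ 1 fun t : ℝ => φ (t, x) :=
    (hφ.1.of_le (by simp)).comp (by fun_prop)
  have hs : HasCompactSupport fun t : ℝ => φ (t, x) :=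
    hφ.hasCompactSupport_comp <| Topology.IsClosedEmbedding.of_continuous_injective_isClosedMap
      (by fun_prop) (fun x y h => (Prod.ext_iff.1 h).1) (isClosedMap_prodMk_right x)
  suffices h : ∫ t in Ioi (0 : ℝ), dt φ (t, x) = -φ (0, x) by
    dsimp only
    rw [integral_const_mul, h, mul_neg]
  rw [← hs.integral_Ioi_deriv_eq hc]
  congr 1
  ext t
  have h1 : HasDerivAt (fun t : ℝ => ((t, x) : SpaceTime n)) (1, 0) t :=
    (hasDerivAt_id t).prodMk (hasDerivAt_const t x)
  exact ((hφ.differentiable (t, x)).hasFDerivAt.comp_hasDerivAt t h1).deriv.symm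

/-- Integration across the hyperplane: `∫_{x₀ > 0} ∂₀ φ = - ∫ φ(t, 0, y) dy`. -/
theorem IsTest.integral_halfSpace_dx {n : ℕ} {φ : SpaceTime (n + 1) → ℝ} (hφ : IsTest φ)
    (t : ℝ) :
    ∫ x : Fin (n + 1) → ℝ, (if 0 < x 0 then 1 else 0) * dx 0 φ (t, x) =
      -∫ y : Fin n → ℝ, φ (t, Fin.cons 0 y) := by
  have hm : Measurable fun x : Fin (n + 1) → ℝ => if 0 < x 0 then (1 : ℝ) else 0 :=
    Measurable.ite (measurableSet_lt measurable_const (by fun_prop)) measurable_const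
      measurable_const
  have hi : Integrable (fun x : Fin (n + 1) → ℝ =>
      (if 0 < x 0 then (1 : ℝ) else 0) * dx 0 φ (t, x)) := by
    refine Integrable.bdd_mul (c := 1) ?_ hm.aestronglyMeasurable (ae_of_all _ fun z => ?_)
    · refine Continuous.integrable_of_hasCompactSupport
        ((hφ.continuous_fderiv_apply _).comp (by fun_prop)) ?_
      exact (hφ.2.fderiv_apply ℝ _).comp_isClosedEmbedding (isClosedEmbedding_time_slice t)
    · split_ifs <;> simp
  -- Separate the coordinate `x₀` from the others and integrate in `x₀` first, where the fundamental
  -- theorem of calculus applies on the half line.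
  have hp := (volume_preserving_piFinSuccAbove (fun _ : Fin (n + 1) => ℝ) 0).symm
  rw [← hp.integral_comp (MeasurableEquiv.measurableEmbedding _), Measure.volume_eq_prod,
    integral_prod_symm, ← integral_neg]
  · congr 1
    ext y
    have hc : ContDiff ℝ 1 fun a : ℝ => φ (t, Fin.cons a y) := by
      refine (hφ.1.of_le (by simp)).comp (contDiff_const.prodMk (contDiff_pi.2 fun i => ?_))
      refine Fin.cases ?_ (fun j => ?_) i <;> simp only [Fin.cons_zero, Fin.cons_succ] <;> fun_prop
    have hs : HasCompactSupport fun a : ℝ => φ (t, Fin.cons a y) := by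
      refine hφ.hasCompactSupport_comp (f := fun a : ℝ => (t, Fin.cons a y)) ?_
      refine (Function.LeftInverse.isClosedEmbedding (f := fun z : SpaceTime (n + 1) => z.2 0)
        (fun a => by simp) (by fun_prop) ?_)
      refine continuous_const.prodMk (continuous_pi fun i => ?_)
      refine Fin.cases ?_ (fun j => ?_) i <;> simp only [Fin.cons_zero, Fin.cons_succ] <;> fun_prop
    rw [← hs.integral_Ioi_deriv_eq hc, ← integral_indicator measurableSet_Ioi]
    congr 1
    ext a
    have h1 : HasDerivAt (fun a : ℝ => ((t, Fin.cons a y) : SpaceTime (n + 1)))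
        (0, Pi.single 0 1) a := by
      refine (hasDerivAt_const a t).prodMk (hasDerivAt_pi.2 fun i => ?_)
      refine Fin.cases ?_ (fun j => ?_) i
      · simpa using hasDerivAt_id' a
      · simpa using hasDerivAt_const a (y j)
    have h2 := ((hφ.differentiable (t, Fin.cons a y)).hasFDerivAt.comp_hasDerivAt a h1).deriv
    have h3 : deriv (fun a : ℝ => φ (t, Fin.cons a y)) a = dx 0 φ (t, Fin.cons a y) := h2
    simp only [indicator, mem_Ioi, h3, MeasurableEquiv.piFinSuccAbove_symm_apply,
      Fin.insertNthEquiv_zero, Fin.consEquiv_apply, Fin.cons_zero, ite_mul, one_mul, zero_mul]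
    rfl
  · exact (hp.integrable_comp_emb (MeasurableEquiv.measurableEmbedding _)).2 hi

/-- `∫_{t > 0} ∫ φ(t, r t, y) dy dt`, the integral of `φ` over the hyperplane `x₀ = r t`. -/
def planeIntegral {n : ℕ} (r : ℝ) (φ : SpaceTime (n + 1) → ℝ) : ℝ :=
  ∫ t in Ioi (0 : ℝ), ∫ y : Fin n → ℝ, φ (t, Fin.cons (r * t) y)

theorem planeIntegral_nonneg {n : ℕ} (r : ℝ) {φ : SpaceTime (n + 1) → ℝ} (h : ∀ z, 0 ≤ φ z) :
    0 ≤ planeIntegral r φ :=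
  integral_nonneg fun _ => integral_nonneg fun _ => h _

/-- The step function `1_{x₀ > r t}`. -/
def step {n : ℕ} (r : ℝ) (z : SpaceTime (n + 1)) : ℝ := if r * z.1 < z.2 0 then 1 else 0

theorem step_shear {n : ℕ} (r : ℝ) (z : SpaceTime (n + 1)) :
    step r (shear n r z) = if 0 < z.2 0 then 1 else 0 := by
  simp [step, shear_apply, mul_comm]

theorem abs_step_le {n : ℕ} (r : ℝ) (z : SpaceTime (n + 1)) : |step r z| ≤ 1 := by
  unfold step; split_ifs <;> simp

theorem measurable_step {n : ℕ} : Measurable fun p : SpaceTime (n + 1) × ℝ => step p.2 p.1 :=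
  Measurable.ite (measurableSet_lt (by fun_prop) (by fun_prop)) measurable_const measurable_const

/-- After the shear the step does not depend on time, so only the initial trace survives. The
right-hand side does not depend on `r`; this is what makes superpositions of steps of different
speeds computable. -/
theorem IsTest.integral_step_transport {n : ℕ} {φ : SpaceTime (n + 1) → ℝ} (hφ : IsTest φ)
    (r : ℝ) :
    ∫ z in future (n + 1), step r z * (dt φ z + r * dx 0 φ z) =
      -∫ x : Fin (n + 1) → ℝ, (if 0 < x 0 then 1 else 0) * φ (0, x) := by
  rw [← setIntegral_future_shear n r]
  simp only [step_shear, ← dt_comp_shear]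
  rw [(hφ.shear r).integral_future_dt (χ := fun x => if 0 < x 0 then 1 else 0)
    (Measurable.ite (measurableSet_lt measurable_const (by fun_prop)) measurable_const
      measurable_const) (fun x => by split_ifs <;> simp)]
  simp [shear_apply]

theorem IsTest.integral_step_dx {n : ℕ} {φ : SpaceTime (n + 1) → ℝ} (hφ : IsTest φ)
    (r : ℝ) :
    ∫ z in future (n + 1), step r z * dx 0 φ z = -planeIntegral r φ := by
  rw [← setIntegral_future_shear n r]
  simp only [step_shear, ← dx_zero_comp_shear]
  have hm : Measurable fun z : SpaceTime (n + 1) => if 0 < z.2 0 then (1 : ℝ) else 0 :=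
    Measurable.ite (measurableSet_lt measurable_const (by fun_prop)) measurable_const
      measurable_const
  have hi : Integrable (fun z => (if 0 < z.2 0 then (1 : ℝ) else 0) *
      dx 0 (fun z => φ (Kerr.shear n r z)) z)
      ((volume.restrict (Ioi (0 : ℝ))).prod (volume : Measure (Fin (n + 1) → ℝ))) := by
    rw [← volume_restrict_future]
    refine (((hφ.shear r).integrable_dx 0).integrableOn).bdd_mul (c := 1) hm.aestronglyMeasurable
      (ae_of_all _ fun z => ?_)
    split_ifs <;> simp
  rw [volume_restrict_future, integral_prod _ hi, planeIntegral, ← integral_neg]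
  congr 1
  ext t
  dsimp only
  rw [(hφ.shear r).integral_halfSpace_dx]
  congr 2
  ext y
  rw [shear_apply]
  congr 2
  ext i
  refine Fin.cases ?_ (fun j => ?_) i <;> simp [mul_comm]

theorem integrableOn_step_mul {n : ℕ} {f : SpaceTime (n + 1) → ℝ} (hf : Integrable f)
    (r : ℝ) : IntegrableOn (fun z => step r z * f z) (future (n + 1)) :=
  hf.integrableOn.bdd_mul (c := 1)
    (measurable_step.comp (measurable_id.prodMk measurable_const)).aestronglyMeasurable
    (ae_of_all _ fun z => abs_step_le r z)

/-- A function invariant by translation along `e_j` is in the kernel of `∂_j`. -/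
theorem IsTest.integral_mul_dx_eq_zero {n : ℕ} {φ : SpaceTime n → ℝ} (hφ : IsTest φ)
    (j : Fin n) {A : SpaceTime n → ℝ} (hA : Measurable A) {C : ℝ} (hC : ∀ z, |A z| ≤ C)
    (hinv : ∀ z (τ : ℝ), A (z + τ • (0, Pi.single j 1)) = A z) :
    ∫ z in future n, A z * dx j φ z = 0 := by
  have hmf : MeasurableSet (future n) := measurableSet_Ioi.prod MeasurableSet.univ
  have hf : Measurable ((future n).indicator A) := hA.indicator hmf
  have hb : ∀ᵐ z : SpaceTime n, ‖(future n).indicator A z‖ ≤ C :=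
    ae_of_all _ fun z => (norm_indicator_le_norm_self _ _).trans (hC z)
  have : (volume : Measure (SpaceTime n)).IsAddHaarMeasure :=
    inferInstanceAs ((volume : Measure ℝ).prod (volume : Measure (Fin n → ℝ))).IsAddHaarMeasure
  -- Integrate by parts along `e_j`. The direction is purely spatial, so the cut-off to `t > 0` is
  -- invariant too and the derivative falling on it is `0`.
  have h := integral_bilinear_hasLineDerivAt_right_eq_neg_left_of_integrable
    (μ := (volume : Measure (SpaceTime n))) (f := (future n).indicator A) (f' := fun _ => 0)
    (g := φ) (g' := dx j φ) (v := (0, Pi.single j 1)) (B := ContinuousLinearMap.mul ℝ ℝ)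
    (by simp) ((hφ.integrable_dx j).bdd_mul hf.aestronglyMeasurable hb)
    ((hφ.1.continuous.integrable_of_hasCompactSupport hφ.2).bdd_mul hf.aestronglyMeasurable hb)
    (fun z _ => by
      have : (fun τ : ℝ => (future n).indicator A (z + τ • (0, Pi.single j 1))) =
          fun _ => (future n).indicator A z := by
        ext τ
        simp only [indicator, future, mem_prod, mem_Ioi, Prod.fst_add, Prod.smul_fst, smul_zero,
          add_zero, mem_univ, hinv]
      unfold HasLineDerivAt
      rw [this]
      exact hasDerivAt_const _ _)
    (fun z _ => (hφ.differentiable z).hasFDerivAt.hasLineDerivAt _)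
  rw [← integral_indicator hmf]
  have h0 : ∀ z, (future n).indicator (fun z => A z * dx j φ z) z =
      (future n).indicator A z * dx j φ z := fun z => by
    by_cases hz : z ∈ future n <;> simp [hz]
  simp only [h0]
  simpa using h

/-! ### Scalar balance laws for functions of `x₀ / t` -/

/-- The ratio `x₀ / t`. -/
def ratio {n : ℕ} (z : SpaceTime (n + 1)) : ℝ := z.2 0 / z.1

theorem measurable_ratio {n : ℕ} : Measurable (ratio (n := n)) := by
  unfold ratio; fun_prop

theorem ratio_add_tangential {n : ℕ} {j : Fin (n + 1)} (hj : j ≠ 0) (z : SpaceTime (n + 1))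
    (τ : ℝ) : ratio (z + τ • (0, Pi.single j 1)) = ratio z := by
  simp [ratio, hj.symm]

/-- Bounded measurable functions of one variable. -/
def BddMeasurable (A : ℝ → ℝ) : Prop := Measurable A ∧ ∃ C, ∀ ξ, |A ξ| ≤ C

theorem BddMeasurable.const (a : ℝ) : BddMeasurable fun _ => a :=
  ⟨measurable_const, |a|, fun _ => le_rfl⟩

theorem BddMeasurable.add {A B : ℝ → ℝ} (hA : BddMeasurable A) (hB : BddMeasurable B) :
    BddMeasurable fun ξ => A ξ + B ξ := by
  obtain ⟨hA, C, hC⟩ := hA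
  obtain ⟨hB, C', hC'⟩ := hB
  exact ⟨hA.add hB, C + C', fun ξ => (abs_add_le _ _).trans (add_le_add (hC ξ) (hC' ξ))⟩

theorem BddMeasurable.jump (a b s : ℝ) : BddMeasurable fun ξ => if s < ξ then b else a := by
  refine ⟨Measurable.ite measurableSet_Ioi measurable_const measurable_const, max |a| |b|,
    fun ξ => ?_⟩
  dsimp only
  split_ifs <;> simp

theorem BddMeasurable.integrableOn {A : ℝ → ℝ} (hA : BddMeasurable A) {n : ℕ}
    {f : SpaceTime (n + 1) → ℝ} (hf : Integrable f) :
    IntegrableOn (fun z => A (ratio z) * f z) (future (n + 1)) := by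
  obtain ⟨hA, C, hC⟩ := hA
  exact hf.integrableOn.bdd_mul (c := C) (hA.comp measurable_ratio).aestronglyMeasurable
    (ae_of_all _ fun z => hC _)

theorem BddMeasurable.integrableOn_pairing {A B : ℝ → ℝ} (hA : BddMeasurable A)
    (hB : BddMeasurable B) {n : ℕ} {φ : SpaceTime (n + 1) → ℝ} (hφ : IsTest φ) :
    IntegrableOn (fun z => A (ratio z) * dt φ z + B (ratio z) * dx 0 φ z) (future (n + 1)) :=
  (hA.integrableOn hφ.integrable_dt).add (hB.integrableOn (hφ.integrable_dx 0))

theorem BddMeasurable.integral_mul_dx {A : ℝ → ℝ} (hA : BddMeasurable A) {n : ℕ}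
    {φ : SpaceTime (n + 1) → ℝ} (hφ : IsTest φ) {j : Fin (n + 1)} (hj : j ≠ 0) :
    ∫ z in future (n + 1), A (ratio z) * dx j φ z = 0 := by
  obtain ⟨hA, C, hC⟩ := hA
  exact hφ.integral_mul_dx_eq_zero j (hA.comp measurable_ratio) (C := C) (fun z => hC _)
    fun z τ => by rw [ratio_add_tangential hj]

/-- `∂_t A(x₀/t) + ∂₀ B(x₀/t) = m δ_{x₀ = s t}` in the weak sense, with Riemann data
`AL`, `AR` for `A` at `t = 0`. -/
structure Balance (A B : ℝ → ℝ) (AL AR s m : ℝ) : Prop where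
  bdd_left : BddMeasurable A
  bdd_right : BddMeasurable B
  weak : ∀ (n : ℕ) (φ : SpaceTime (n + 1) → ℝ), IsTest φ →
    (∫ z in future (n + 1), (A (ratio z) * dt φ z + B (ratio z) * dx 0 φ z)) +
      ∫ x : Fin (n + 1) → ℝ, (if x 0 < 0 then AL else AR) * φ (0, x) = -m * planeIntegral s φ

theorem integrable_initial_ite {n : ℕ} {φ : SpaceTime (n + 1) → ℝ} (hφ : IsTest φ) (a b : ℝ) :
    Integrable fun x : Fin (n + 1) → ℝ => (if x 0 < 0 then a else b) * φ (0, x) := by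
  refine hφ.integrable_initial.bdd_mul (c := max |a| |b|) (Measurable.ite (measurableSet_lt
    (by fun_prop) measurable_const) measurable_const measurable_const).aestronglyMeasurable
    (ae_of_all _ fun x => ?_)
  split_ifs <;> simp

theorem Balance.add {A B A' B' : ℝ → ℝ} {AL AR AL' AR' s m m' : ℝ}
    (h : Balance A B AL AR s m) (h' : Balance A' B' AL' AR' s m') :
    Balance (fun ξ => A ξ + A' ξ) (fun ξ => B ξ + B' ξ) (AL + AL') (AR + AR') s (m + m') := by
  refine ⟨h.bdd_left.add h'.bdd_left, h.bdd_right.add h'.bdd_right, fun n φ hφ => ?_⟩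
  have e1 : ∀ z : SpaceTime (n + 1),
      (A (ratio z) + A' (ratio z)) * dt φ z + (B (ratio z) + B' (ratio z)) * dx 0 φ z =
      (A (ratio z) * dt φ z + B (ratio z) * dx 0 φ z) +
      (A' (ratio z) * dt φ z + B' (ratio z) * dx 0 φ z) := fun z => by ring
  have e2 : ∀ x : Fin (n + 1) → ℝ, (if x 0 < 0 then AL + AL' else AR + AR') * φ (0, x) =
      (if x 0 < 0 then AL else AR) * φ (0, x) + (if x 0 < 0 then AL' else AR') * φ (0, x) :=
    fun x => by split_ifs <;> ring
  simp only [e1, e2]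
  rw [integral_add (h.bdd_left.integrableOn_pairing h.bdd_right hφ)
    (h'.bdd_left.integrableOn_pairing h'.bdd_right hφ),
    integral_add (integrable_initial_ite hφ _ _) (integrable_initial_ite hφ _ _),
    neg_add, add_mul, ← h.weak n φ hφ, ← h'.weak n φ hφ]
  ring

theorem Balance.const (a b s : ℝ) : Balance (fun _ => a) (fun _ => b) a a s 0 := by
  refine ⟨.const a, .const b, fun n φ hφ => ?_⟩
  have h1 := hφ.integral_future_dt (χ := fun _ => 1) measurable_const (by simp)
  have h2 := hφ.integral_mul_dx_eq_zero 0 (A := fun _ => 1) measurable_const (C := 1) (by simp)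
    (by simp)
  simp only [one_mul] at h1 h2
  rw [integral_add (hφ.integrable_dt.integrableOn.const_mul a)
    ((hφ.integrable_dx 0).integrableOn.const_mul b)]
  simp only [ite_self]
  rw [integral_const_mul, integral_const_mul, integral_const_mul, h1, h2]
  ring

theorem ae_apply_ne_zero (n : ℕ) : ∀ᵐ x : Fin (n + 1) → ℝ, x 0 ≠ 0 := by
  rw [ae_iff]
  simpa [volume_pi] using
    Measure.pi_hyperplane (fun _ : Fin (n + 1) => (volume : Measure ℝ)) 0 0

/-- The Riemann datum and the step at `t = 0` disagree only on the null plane `x₀ = 0`. -/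
theorem integral_initial_step {n : ℕ} (φ : SpaceTime (n + 1) → ℝ) (a : ℝ) :
    ∫ x : Fin (n + 1) → ℝ, (if x 0 < 0 then 0 else a) * φ (0, x) =
      a * ∫ x : Fin (n + 1) → ℝ, (if 0 < x 0 then 1 else 0) * φ (0, x) := by
  rw [← integral_const_mul]
  refine integral_congr_ae ?_
  filter_upwards [ae_apply_ne_zero n] with x hx
  rcases lt_or_gt_of_ne hx with h | h
  · simp [h, h.not_gt]
  · simp [h, h.not_gt]

theorem step_eq_of_mem_future {n : ℕ} {z : SpaceTime (n + 1)} (hz : z ∈ future (n + 1)) (r : ℝ) :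
    step r z = if r < ratio z then 1 else 0 := by
  have : 0 < z.1 := hz.1
  simp only [step, ratio, lt_div_iff₀ this]

theorem measurableSet_future (n : ℕ) : MeasurableSet (future n) :=
  measurableSet_Ioi.prod MeasurableSet.univ

/-- A jump of `(A, B)` from `0` to `(a, b)` at `ξ = s`. -/
theorem Balance.jump (a b s : ℝ) :
    Balance (fun ξ => if s < ξ then a else 0) (fun ξ => if s < ξ then b else 0) 0 a s
      (b - s * a) := by
  refine ⟨.jump 0 a s, .jump 0 b s, fun n φ hφ => ?_⟩
  -- Split `a ∂_t + b ∂₀ = a (∂_t + s ∂₀) + (b - s a) ∂₀`. The first part cancels the initial term,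
  -- the second is the mass on the plane `x₀ = s t`.
  have e : ∫ z in future (n + 1), ((if s < ratio z then a else 0) * dt φ z +
      (if s < ratio z then b else 0) * dx 0 φ z) = ∫ z in future (n + 1),
        (a * (step s z * (dt φ z + s * dx 0 φ z)) + (b - s * a) * (step s z * dx 0 φ z)) := by
    refine setIntegral_congr_fun (measurableSet_future _) fun z hz => ?_
    simp only [step_eq_of_mem_future hz]
    split_ifs <;> ring
  rw [e, integral_add, integral_const_mul, integral_const_mul, hφ.integral_step_transport,
    hφ.integral_step_dx, integral_initial_step]
  · ring
  · exact (integrableOn_step_mul (hφ.integrable_dt.add ((hφ.integrable_dx 0).const_mul s))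
      s).const_mul a
  · exact (integrableOn_step_mul (hφ.integrable_dx 0) s).const_mul _

theorem Balance.shock (aL aR bL bR s : ℝ) :
    Balance (fun ξ => if s < ξ then aR else aL) (fun ξ => if s < ξ then bR else bL) aL aR s
      (-s * (aR - aL) + (bR - bL)) := by
  convert (Balance.const aL bL s).add (Balance.jump (aR - aL) (bR - bL) s) using 1
  · ext ξ; split_ifs <;> ring
  · ext ξ; split_ifs <;> ring
  all_goals ring

/-- Superposition of steps with density `f'` on `[a, b]`. -/
theorem setIntegral_step_mul_deriv {f f' : ℝ → ℝ} {a b : ℝ} (hab : a ≤ b)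
    (hf : ∀ r ∈ Icc a b, HasDerivAt f (f' r) r) (hf' : ContinuousOn f' (Icc a b)) (ξ : ℝ) :
    ∫ r in Ioc a b, (if r < ξ then 1 else 0) * f' r = f (max a (min ξ b)) - f a := by
  have hle : a ≤ max a (min ξ b) := le_max_left _ _
  have hle' : max a (min ξ b) ≤ b := max_le hab (min_le_right _ _)
  have h1 : ∫ r in Ioc a b, (if r < ξ then 1 else 0) * f' r =
      ∫ r in Ioc a b, (Iio ξ).indicator f' r := by
    congr 1; ext r; simp [indicator]
  have h2 : (Ioc a b ∩ Iio ξ : Set ℝ) =ᵐ[volume] Ioc a (max a (min ξ b)) := by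
    have : Ioc a (max a (min ξ b)) = Ioc a b ∩ Iic ξ := by
      ext r
      simp only [mem_Ioc, mem_inter_iff, mem_Iic, le_max_iff, le_min_iff]
      constructor
      · rintro ⟨h, h' | h'⟩
        · exact absurd h' h.not_ge
        · exact ⟨⟨h, h'.2⟩, h'.1⟩
      · rintro ⟨⟨h, h'⟩, h''⟩
        exact ⟨h, Or.inr ⟨h'', h'⟩⟩
    rw [this]
    exact (ae_eq_refl _).inter Iio_ae_eq_Iic
  rw [h1, setIntegral_indicator measurableSet_Iio, setIntegral_congr_set h2,
    ← intervalIntegral.integral_of_le hle]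
  have hsub : uIcc a (max a (min ξ b)) ⊆ Icc a b := by
    rw [uIcc_of_le hle]; exact Icc_subset_Icc_right hle'
  exact intervalIntegral.integral_eq_sub_of_hasDerivAt (fun r hr => hf r (hsub hr))
    (hf'.mono hsub).intervalIntegrable

theorem BddMeasurable.clamp {f : ℝ → ℝ} {a b : ℝ} (hab : a ≤ b)
    (hf : ContinuousOn f (Icc a b)) : BddMeasurable fun ξ => f (max a (min ξ b)) := by
  have hm : ∀ ξ, max a (min ξ b) ∈ Icc a b := fun ξ =>
    ⟨le_max_left _ _, max_le hab (min_le_right _ _)⟩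
  have hc : Continuous fun ξ => f (max a (min ξ b)) :=
    hf.comp_continuous (by fun_prop) hm
  obtain ⟨C, hC⟩ := isCompact_Icc.exists_bound_of_continuousOn hf
  exact ⟨hc.measurable, C, fun ξ => hC _ (hm ξ)⟩

/-- A centred rarefaction: `f' = r ↦ f'(r)` and `g'(r) = r f'(r)` on `[a, b]`. -/
theorem Balance.ramp {f g f' : ℝ → ℝ} {a b : ℝ} (hab : a ≤ b)
    (hf : ∀ r ∈ Icc a b, HasDerivAt f (f' r) r) (hg : ∀ r ∈ Icc a b, HasDerivAt g (r * f' r) r)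
    (hf' : ContinuousOn f' (Icc a b)) (s : ℝ) :
    Balance (fun ξ => f (max a (min ξ b)) - f a) (fun ξ => g (max a (min ξ b)) - g a)
      0 (f b - f a) s 0 := by
  have hcf : ContinuousOn f (Icc a b) := fun r hr => (hf r hr).continuousAt.continuousWithinAt
  have hcg : ContinuousOn g (Icc a b) := fun r hr => (hg r hr).continuousAt.continuousWithinAt
  have hrf' : ContinuousOn (fun r => r * f' r) (Icc a b) := continuousOn_id.mul hf'
  refine ⟨.clamp hab (hcf.sub continuousOn_const), .clamp hab (hcg.sub continuousOn_const),
    fun n φ hφ => ?_⟩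
  -- The clamped pair `(f, g)` is the superposition of the steps at `r` with weights `(f' r, r f'
  -- r)`; the relation `g' = r f'` makes each of them a solution of the transport equation with
  -- speed `r`.
  have e : ∫ z in future (n + 1), ((f (max a (min (ratio z) b)) - f a) * dt φ z +
      (g (max a (min (ratio z) b)) - g a) * dx 0 φ z) = ∫ z in future (n + 1),
        ∫ r in Ioc a b, f' r * (step r z * (dt φ z + r * dx 0 φ z)) := by
    refine setIntegral_congr_fun (measurableSet_future _) fun z hz => ?_
    simp only [← setIntegral_step_mul_deriv hab hf hf' (ratio z),
      ← setIntegral_step_mul_deriv hab hg hrf' (ratio z), ← step_eq_of_mem_future hz]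
    have hi : ∀ k : ℝ → ℝ, ContinuousOn k (Icc a b) →
        IntegrableOn (fun r => step r z * k r) (Ioc a b) := fun k hk =>
      ((hk.integrableOn_Icc).mono_set Ioc_subset_Icc_self).bdd_mul (c := 1)
        (measurable_step.comp (measurable_const.prodMk measurable_id)).aestronglyMeasurable
        (ae_of_all _ fun r => abs_step_le r z)
    rw [← integral_mul_const, ← integral_mul_const,
      ← integral_add ((hi f' hf').mul_const _) ((hi _ hrf').mul_const _)]
    congr 1
    ext r
    ring
  have hif : IntegrableOn f' (Ioc a b) := hf'.integrableOn_Icc.mono_set Ioc_subset_Icc_self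
  have hirf : IntegrableOn (fun r => r * f' r) (Ioc a b) :=
    hrf'.integrableOn_Icc.mono_set Ioc_subset_Icc_self
  have hint : Integrable (Function.uncurry fun (z : SpaceTime (n + 1)) (r : ℝ) =>
      f' r * (step r z * (dt φ z + r * dx 0 φ z)))
      ((volume.restrict (future (n + 1))).prod (volume.restrict (Ioc a b))) := by
    have h1 := ((hφ.integrable_dt.integrableOn (s := future (n + 1))).mul_prod hif).add
      (((hφ.integrable_dx 0).integrableOn (s := future (n + 1))).mul_prod hirf)
    have h2 := h1.bdd_mul (c := 1) (measurable_step (n := n)).aestronglyMeasurable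
      (ae_of_all _ fun p => abs_step_le p.2 p.1)
    refine h2.congr (ae_of_all _ fun p => ?_)
    simp only [Function.uncurry, Pi.add_apply]
    ring
  -- After Fubini every step contributes the same initial term, weighted by `f' r`, and the weights
  -- add up to `f b - f a`.
  rw [e, integral_integral_swap hint]
  simp only [integral_const_mul, hφ.integral_step_transport, integral_mul_const]
  rw [integral_initial_step]
  have h4 : ∫ r in Ioc a b, f' r = f b - f a := by
    rw [← intervalIntegral.integral_of_le hab]
    refine intervalIntegral.integral_eq_sub_of_hasDerivAt (fun r hr => hf r ?_)
      (hf'.mono ?_).intervalIntegrable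
    · rwa [uIcc_of_le hab] at hr
    · rw [uIcc_of_le hab]
  rw [h4]
  ring

/-- The states of interest lie in a plane spanned by two fixed vectors (the directions of `D₂` and
`H₃`), so the vector identity splits into two scalar balances. Transverse fluxes need not vanish,
but they are functions of `x₀ / t` and hence drop out. -/
theorem weakForm_of_balance {X : Type*} [NormedAddCommGroup X] [NormedSpace ℝ X]
    [CompleteSpace X] {n : ℕ}
    {A B A' B' : ℝ → ℝ} {AL AR AL' AR' s m m' : ℝ}
    (h : Balance A B AL AR s m) (h' : Balance A' B' AL' AR' s m') (x x' : X)
    {T : Fin n → ℝ → ℝ} (hT : ∀ j, BddMeasurable (T j)) (y : Fin n → X)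
    {w : SpaceTime (n + 1) → X} {G : Fin (n + 1) → SpaceTime (n + 1) → X}
    {w₀ : (Fin (n + 1) → ℝ) → X}
    (hw : ∀ z, w z = A (ratio z) • x + A' (ratio z) • x')
    (hG₀ : ∀ z, G 0 z = B (ratio z) • x + B' (ratio z) • x')
    (hG : ∀ j z, G (Fin.succ j) z = T j (ratio z) • y j)
    (hw₀ : ∀ a, w₀ a = (if a 0 < 0 then AL else AR) • x + (if a 0 < 0 then AL' else AR') • x')
    {φ : SpaceTime (n + 1) → ℝ} (hφ : IsTest φ) :
    weakForm w G w₀ φ = (-m * planeIntegral s φ) • x + (-m' * planeIntegral s φ) • x' := by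
  have e1 : ∀ z, dt φ z • w z + ∑ j, dx j φ z • G j z =
      (A (ratio z) * dt φ z + B (ratio z) * dx 0 φ z) • x +
      (A' (ratio z) * dt φ z + B' (ratio z) * dx 0 φ z) • x' +
      ∑ j, (T j (ratio z) * dx (Fin.succ j) φ z) • y j := fun z => by
    rw [Fin.sum_univ_succ, hw, hG₀]
    simp only [hG, smul_smul]
    rw [← add_assoc]
    congr 1
    · module
    · exact Finset.sum_congr rfl fun j _ => by rw [mul_comm]
  have e2 : ∀ a, φ (0, a) • w₀ a = ((if a 0 < 0 then AL else AR) * φ (0, a)) • x +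
      ((if a 0 < 0 then AL' else AR') * φ (0, a)) • x' := fun a => by
    rw [hw₀]; module
  have i1 := h.bdd_left.integrableOn_pairing h.bdd_right hφ
  have i2 := h'.bdd_left.integrableOn_pairing h'.bdd_right hφ
  have i3 : ∀ j, IntegrableOn (fun z => T j (ratio z) * dx (Fin.succ j) φ z) (future (n + 1)) :=
    fun j => (hT j).integrableOn (hφ.integrable_dx _)
  have i12 : IntegrableOn (fun z => (A (ratio z) * dt φ z + B (ratio z) * dx 0 φ z) • x +
      (A' (ratio z) * dt φ z + B' (ratio z) * dx 0 φ z) • x') (future (n + 1)) :=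
    (i1.smul_const x).add (i2.smul_const x')
  unfold weakForm
  simp only [e1, e2]
  rw [integral_add i12 (integrable_finsetSum _ fun j _ => (i3 j).smul_const _),
    integral_add (i1.smul_const x) (i2.smul_const x'),
    integral_finsetSum _ fun j _ => (i3 j).smul_const _,
    integral_add ((integrable_initial_ite hφ _ _).smul_const x)
      ((integrable_initial_ite hφ _ _).smul_const x')]
  have h0 : ∀ j, ∫ z in future (n + 1), T j (ratio z) * dx (Fin.succ j) φ z = 0 :=
    fun j => (hT j).integral_mul_dx hφ (Fin.succ_ne_zero j)
  simp only [integral_smul_const, h0, zero_smul,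
    Finset.sum_const_zero, add_zero]
  rw [← h.weak n φ hφ, ← h'.weak n φ hφ]
  module

theorem BddMeasurable.memLp_smul {A : ℝ → ℝ} (hA : BddMeasurable A) {X : Type*}
    [NormedAddCommGroup X] [NormedSpace ℝ X] (x : X) {n : ℕ} (μ : Measure (SpaceTime (n + 1))) :
    MemLp (fun z => A (ratio z) • x) ⊤ μ := by
  obtain ⟨hA, C, hC⟩ := hA
  refine memLp_top_of_bound
    ((hA.comp measurable_ratio).stronglyMeasurable.smul_const x).aestronglyMeasurable (C * ‖x‖)
    (ae_of_all _ fun z => ?_)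
  rw [norm_smul]
  exact mul_le_mul_of_nonneg_right (hC _) (norm_nonneg x)

theorem isWeakSolution_of_balance {X : Type*} [NormedAddCommGroup X] [NormedSpace ℝ X]
    [CompleteSpace X] {n : ℕ}
    {A B A' B' : ℝ → ℝ} {AL AR AL' AR' s : ℝ}
    (h : Balance A B AL AR s 0) (h' : Balance A' B' AL' AR' s 0) (x x' : X)
    {T : Fin n → ℝ → ℝ} (hT : ∀ j, BddMeasurable (T j)) (y : Fin n → X)
    {F : Fin (n + 1) → X → X} {u₀ : (Fin (n + 1) → ℝ) → X} {u : SpaceTime (n + 1) → X}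
    (hu : ∀ z, u z = A (ratio z) • x + A' (ratio z) • x')
    (hF₀ : ∀ z, F 0 (u z) = B (ratio z) • x + B' (ratio z) • x')
    (hF : ∀ j z, F (Fin.succ j) (u z) = T j (ratio z) • y j)
    (hu₀ : ∀ a, u₀ a = (if a 0 < 0 then AL else AR) • x + (if a 0 < 0 then AL' else AR') • x') :
    IsWeakSolution F u₀ u := by
  refine ⟨?_, fun φ hφ => ?_⟩
  · rw [funext hu]
    exact (h.bdd_left.memLp_smul x _).add (h'.bdd_left.memLp_smul x' _)
  · rw [weakForm_of_balance h h' x x' hT y hu hF₀ hF hu₀ hφ]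
    simp

/-! ### Kerr states with `E` parallel to `e₂` -/

namespace Medium

variable (M : Medium)

theorem p_q (e : ℝ) : M.p (M.q e) = e := (Equiv.ofBijective M.q M.q_bijective).symm_apply_apply e

theorem q_p (d : ℝ) : M.q (M.p d) = d := (Equiv.ofBijective M.q M.q_bijective).apply_symm_apply d

theorem q_neg (e : ℝ) : M.q (-e) = -M.q e := by unfold q; ring

theorem abs_q (e : ℝ) : |M.q e| = M.q |e| := by
  have h0 := M.ε₀_pos
  have h1 := M.εr_pos
  have : 0 ≤ M.q |e| := by unfold q; positivity
  rcases abs_cases e with ⟨h, _⟩ | ⟨h, _⟩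
  · rw [h] at this ⊢; exact abs_of_nonneg this
  · rw [h] at this ⊢
    rw [q_neg] at this ⊢
    exact abs_of_nonpos (by linarith)

theorem q_eq (e : ℝ) : M.q e = M.ε₀ * (1 + M.εr * e ^ 2) * e := by unfold q; ring

theorem one_add_pos {k : ℝ} (hk : 0 ≤ k) (e : ℝ) : 0 < 1 + k * M.εr * e ^ 2 := by
  have := M.εr_pos
  positivity

theorem one_add_sq_pos (e : ℝ) : 0 < 1 + M.εr * e ^ 2 := by
  have := M.εr_pos
  positivity

theorem p_abs_q_sq (e : ℝ) : M.p |M.q e| ^ 2 = e ^ 2 := by rw [abs_q, p_q, sq_abs]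

theorem eField_of_eLen {n : ℕ} (D : Fin n → ℝ) (e : ℝ) (h : eLen D = |M.q e|) :
    M.eField D = (M.ε₀ * (1 + M.εr * e ^ 2))⁻¹ • D := by
  rw [eField, h, p_abs_q_sq]

theorem inv_mul_q (e : ℝ) : (M.ε₀ * (1 + M.εr * e ^ 2))⁻¹ * M.q e = e := by
  have h := M.one_add_sq_pos e
  have h0 := M.ε₀_pos
  rw [q_eq]
  field_simp

theorem eField_two (e : ℝ) : M.eField ![0, M.q e] = ![0, e] := by
  rw [M.eField_of_eLen _ e (by simp [eLen, Real.sqrt_mul_self_eq_abs])]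
  simp [inv_mul_q, -mul_inv_rev]

theorem eField_three (e : ℝ) : M.eField ![0, M.q e, 0] = ![0, e, 0] := by
  rw [M.eField_of_eLen _ e (by simp [eLen, Real.sqrt_mul_self_eq_abs])]
  simp [inv_mul_q, -mul_inv_rev]

theorem eLen_two (x : ℝ) : eLen ![0, x] = |x| := by simp [eLen, Real.sqrt_mul_self_eq_abs]

theorem eLen_three (x : ℝ) : eLen ![0, x, 0] = |x| := by
  simp [eLen, Real.sqrt_mul_self_eq_abs]

theorem eLen_three' (x : ℝ) : eLen ![0, 0, x] = |x| := by
  simp [eLen, Real.sqrt_mul_self_eq_abs]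

/-- The energy density in terms of `E₂` and `H₃`. -/
def energy (e H : ℝ) : ℝ := M.ε₀ / 2 * (e ^ 2 + 3 * M.εr / 2 * e ^ 4) + M.μ₀ / 2 * H ^ 2

/-- The eigenvalue `λ` in terms of `E₂` when `E` is orthogonal to the direction. -/
def speed (e : ℝ) : ℝ := M.c / √(1 + 3 * M.εr * e ^ 2)

/-- The state with `E = (0, e)` and magnetic field `H`. -/
def state (e H : ℝ) : TMState := (![0, M.q e], H)

/-- Here `E` is orthogonal to the direction `e₁`, so the factor `1 + εr |E|²` cancels. -/
theorem lam_two (e H : ℝ) : M.lam ![1, 0] (M.state e H).1 = M.speed e := by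
  have h := M.one_add_sq_pos e
  have h3 := M.one_add_pos (by norm_num : (0 : ℝ) ≤ 3) e
  rw [lam, state, speed, eField_two, eLen_two]
  simp only [sq_abs]
  rw [div_eq_mul_inv M.c, ← Real.sqrt_inv]
  congr 2
  simp
  field_simp

theorem tmEnergy_state (e H : ℝ) : tmEnergy M (M.state e H) = M.energy e H := by
  simp only [tmEnergy, electricEnergy, state, eField_two, eLen_two, energy, sq_abs]
  rw [show |e| ^ 4 = e ^ 4 from (even_two_mul 2).pow_abs e]

theorem fullEnergy_state (e H : ℝ) : fullEnergy M (toFull (M.state e H)) = M.energy e H := by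
  simp only [fullEnergy, electricEnergy, toFull, state, Matrix.cons_val_zero, Matrix.cons_val_one,
    eField_three, eLen_three, eLen_three', energy, sq_abs]
  rw [show |e| ^ 4 = e ^ 4 from (even_two_mul 2).pow_abs e]

theorem tmFlux_zero_state (e H : ℝ) :
    tmFlux M 0 (M.state e H) = (![0, H], M.μ₀⁻¹ * e) := by
  simp [tmFlux, state, eField_two]

theorem tmFlux_one_state (e H : ℝ) :
    tmFlux M 1 (M.state e H) = (![-H, 0], 0) := by
  simp [tmFlux, state, eField_two]

theorem dirFlux_tmFlux_state (e H : ℝ) :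
    dirFlux (tmFlux M) ![1, 0] (M.state e H) = (![0, H], M.μ₀⁻¹ * e) := by
  simp [dirFlux, tmFlux_zero_state]

theorem fullFlux_zero_state (e H : ℝ) :
    fullFlux M 0 (toFull (M.state e H)) = (![0, H, 0], ![0, 0, M.μ₀⁻¹ * e]) := by
  simp only [fullFlux, toFull, state, Matrix.cons_val_zero, Matrix.cons_val_one, eField_three]
  ext i <;> fin_cases i <;> simp [cross_apply]

theorem fullFlux_one_state (e H : ℝ) :
    fullFlux M 1 (toFull (M.state e H)) = (![-H, 0, 0], 0) := by
  simp only [fullFlux, toFull, state, Matrix.cons_val_zero, Matrix.cons_val_one, eField_three]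
  ext i <;> fin_cases i <;> simp [cross_apply]

theorem fullFlux_two_state (e H : ℝ) :
    fullFlux M 2 (toFull (M.state e H)) = (0, ![-(M.μ₀⁻¹ * e), 0, 0]) := by
  simp only [fullFlux, toFull, state, Matrix.cons_val_zero, Matrix.cons_val_one, eField_three]
  ext i <;> fin_cases i <;> simp [cross_apply]

theorem fullEnergyFlux_state (e H : ℝ) :
    (fun j => fullEnergyFlux M j (toFull (M.state e H))) = ![H * e, 0, 0] := by
  simp only [fullEnergyFlux, toFull, state, Matrix.cons_val_zero, Matrix.cons_val_one,
    eField_three]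
  ext i
  fin_cases i <;> simp [cross_apply, mul_comm]

end Medium

/-! ### From scalar balances to weak and entropy solutions of both systems -/

theorem selfSimilar_eq {n : ℕ} {X : Type*} {ω : Fin (n + 1) → ℝ} (hω : ω = Pi.single 0 1)
    (V : ℝ → X) (z : SpaceTime (n + 1)) : selfSimilar ω V z = V (ratio z) := by
  simp [selfSimilar, ratio, hω]

theorem vec_two_eq : (![1, 0] : Fin 2 → ℝ) = Pi.single 0 1 := by
  ext i; fin_cases i <;> simp

theorem vec_three_eq : (![1, 0, 0] : Fin 3 → ℝ) = Pi.single 0 1 := by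
  ext i; fin_cases i <;> simp

theorem riemannData_eq {n : ℕ} {X : Type*} {ω : Fin (n + 1) → ℝ} (hω : ω = Pi.single 0 1)
    (ul ur : X) (x : Fin (n + 1) → ℝ) :
    riemannData ω ul ur x = if x 0 < 0 then ul else ur := by
  simp [riemannData, hω]

/-- Balance laws for the profiles `e`, `H` of `E₂` and `H₃`: the TM system holds, and the energy
is produced at the rate `m` along `x₁ = s t`. -/
structure TMBalance (M : Medium) (e H : ℝ → ℝ) (eL HL eR HR s m : ℝ) : Prop where
  electric : Balance (fun ξ => M.q (e ξ)) H (M.q eL) (M.q eR) s 0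
  magnetic : Balance H (fun ξ => M.μ₀⁻¹ * e ξ) HL HR s 0
  energy : Balance (fun ξ => M.energy (e ξ) (H ξ)) (fun ξ => H ξ * e ξ)
    (M.energy eL HL) (M.energy eR HR) s m

namespace TMBalance

variable {M : Medium} {e H : ℝ → ℝ} {eL HL eR HR s m : ℝ}

theorem tm_isWeakSolution (h : TMBalance M e H eL HL eR HR s m) :
    IsWeakSolution (tmFlux M) (riemannData ![1, 0] (M.state eL HL) (M.state eR HR))
      (selfSimilar ![1, 0] fun ξ => M.state (e ξ) (H ξ)) := by
  have hs : ∀ a b : ℝ, M.state a b =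
      M.q a • ((![0, 1], 0) : TMState) + b • ((![0, 0], 1) : TMState) := fun a b => by
    simp [Medium.state]
  refine isWeakSolution_of_balance (n := 1) h.electric h.magnetic ((![0, 1], 0) : TMState)
      ((![0, 0], 1) : TMState) (T := fun _ => H) (fun _ => h.magnetic.bdd_left)
      (fun _ => (![-1, 0], 0)) (fun z => ?_) (fun z => ?_) (fun j z => ?_) (fun x => ?_)
  · rw [selfSimilar_eq vec_two_eq, hs]
  · rw [selfSimilar_eq vec_two_eq, M.tmFlux_zero_state]; simp
  · obtain rfl : j = 0 := Subsingleton.elim _ _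
    rw [selfSimilar_eq vec_two_eq]
    exact (M.tmFlux_one_state _ _).trans (by simp)
  · rw [riemannData_eq vec_two_eq]; split_ifs <;> rw [hs]

theorem full_isWeakSolution (h : TMBalance M e H eL HL eR HR s m) :
    IsWeakSolution (fullFlux M)
      (riemannData ![1, 0, 0] (toFull (M.state eL HL)) (toFull (M.state eR HR)))
      (selfSimilar ![1, 0, 0] fun ξ => toFull (M.state (e ξ) (H ξ))) := by
  have hs : ∀ a b : ℝ, toFull (M.state a b) =
      M.q a • ((![0, 1, 0], 0) : FullState) + b • ((0, ![0, 0, 1]) : FullState) :=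
    fun a b => by simp [Medium.state, toFull]
  refine isWeakSolution_of_balance (n := 2) h.electric h.magnetic ((![0, 1, 0], 0) : FullState)
      ((0, ![0, 0, 1]) : FullState) (T := ![H, fun ξ => M.μ₀⁻¹ * e ξ])
      (fun j => ?_) ![(![-1, 0, 0], 0), (0, ![-1, 0, 0])]
      (fun z => ?_) (fun z => ?_) (fun j z => ?_) (fun x => ?_)
  · fin_cases j
    · exact h.magnetic.bdd_left
    · exact h.magnetic.bdd_right
  · rw [selfSimilar_eq vec_three_eq, hs]
  · rw [selfSimilar_eq vec_three_eq, M.fullFlux_zero_state]; simp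
  · rw [selfSimilar_eq vec_three_eq]
    fin_cases j
    · exact (M.fullFlux_one_state _ _).trans (by simp)
    · exact (M.fullFlux_two_state _ _).trans (by simp)
  · rw [riemannData_eq vec_three_eq]; split_ifs <;> rw [hs]

theorem tm_entropyForm (h : TMBalance M e H eL HL eR HR s m) {φ : SpaceTime 2 → ℝ}
    (hφ : IsTest φ) :
    entropyForm (tmEnergy M) (tmEnergyFlux M)
      (riemannData ![1, 0] (M.state eL HL) (M.state eR HR))
      (selfSimilar ![1, 0] fun ξ => M.state (e ξ) (H ξ)) φ = -m * planeIntegral s φ := by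
  -- The energy is scalar: the second copy of the balance is multiplied by the vector `0`, and the
  -- transverse energy flux vanishes because `E₁ = 0`.
  rw [entropyForm, weakForm_of_balance (n := 1) h.energy h.energy (1 : ℝ) 0 (T := fun _ => H)
    (fun _ => h.magnetic.bdd_left) (fun _ => 0) (fun z => ?_) (fun z => ?_) (fun j z => ?_)
    (fun x => ?_) hφ]
  · simp
  · rw [selfSimilar_eq vec_two_eq, M.tmEnergy_state]; simp
  · rw [selfSimilar_eq vec_two_eq]; simp [tmEnergyFlux, Medium.state, M.eField_two]
  · obtain rfl : j = 0 := Subsingleton.elim _ _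
    rw [selfSimilar_eq vec_two_eq]
    simp [tmEnergyFlux, Medium.state, M.eField_two]
  · rw [riemannData_eq vec_two_eq]; split_ifs <;> simp [M.tmEnergy_state]

theorem full_entropyForm (h : TMBalance M e H eL HL eR HR s m) {φ : SpaceTime 3 → ℝ}
    (hφ : IsTest φ) :
    entropyForm (fullEnergy M) (fullEnergyFlux M)
      (riemannData ![1, 0, 0] (toFull (M.state eL HL)) (toFull (M.state eR HR)))
      (selfSimilar ![1, 0, 0] fun ξ => toFull (M.state (e ξ) (H ξ))) φ =
      -m * planeIntegral s φ := by
  rw [entropyForm, weakForm_of_balance (n := 2) h.energy h.energy (1 : ℝ) 0 (T := fun _ => H)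
    (fun _ => h.magnetic.bdd_left) (fun _ => 0) (fun z => ?_) (fun z => ?_) (fun j z => ?_)
    (fun x => ?_) hφ]
  · simp
  · rw [selfSimilar_eq vec_three_eq, M.fullEnergy_state]; simp
  · rw [selfSimilar_eq vec_three_eq]
    exact (congrFun (M.fullEnergyFlux_state _ _) 0).trans (by simp)
  · rw [selfSimilar_eq vec_three_eq]
    refine (congrFun (M.fullEnergyFlux_state _ _) (Fin.succ j)).trans ?_
    fin_cases j <;> simp
  · rw [riemannData_eq vec_three_eq]; split_ifs <;> simp [M.fullEnergy_state]

theorem tm_isEntropySolution (h : TMBalance M e H eL HL eR HR s m) (hm : m ≤ 0) :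
    IsEntropySolution (tmFlux M) (tmEnergy M) (tmEnergyFlux M)
      (riemannData ![1, 0] (M.state eL HL) (M.state eR HR))
      (selfSimilar ![1, 0] fun ξ => M.state (e ξ) (H ξ)) :=
  ⟨h.tm_isWeakSolution, fun φ hφ hn => by
    rw [h.tm_entropyForm hφ]
    exact mul_nonneg (neg_nonneg.2 hm) (planeIntegral_nonneg s hn)⟩

theorem full_isEntropySolution (h : TMBalance M e H eL HL eR HR s m) (hm : m ≤ 0) :
    IsEntropySolution (fullFlux M) (fullEnergy M) (fullEnergyFlux M)
      (riemannData ![1, 0, 0] (toFull (M.state eL HL)) (toFull (M.state eR HR)))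
      (selfSimilar ![1, 0, 0] fun ξ => toFull (M.state (e ξ) (H ξ))) :=
  ⟨h.full_isWeakSolution, fun φ hφ hn => by
    rw [h.full_entropyForm hφ]
    exact mul_nonneg (neg_nonneg.2 hm) (planeIntegral_nonneg s hn)⟩

end TMBalance

/-! ### A rarefaction, a constant state, a rarefaction and a jump -/

/-- The profile `p₁` on `[a₁, b₁]`, extended by constants up to `a₃`, then `p₃` on `[a₃, s]`,
then the constant `pR`. -/
def profile {X : Type*} (a₁ b₁ a₃ s : ℝ) (p₁ p₃ : ℝ → X) (pR : X) (ξ : ℝ) : X :=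
  if ξ ≤ a₃ then p₁ (max a₁ (min ξ b₁)) else if ξ ≤ s then p₃ ξ else pR

theorem apply_profile {X Y : Type*} (f : X → Y) (a₁ b₁ a₃ s : ℝ) (p₁ p₃ : ℝ → X) (pR : X)
    (ξ : ℝ) : f (profile a₁ b₁ a₃ s p₁ p₃ pR ξ) =
      profile a₁ b₁ a₃ s (fun r => f (p₁ r)) (fun r => f (p₃ r)) (f pR) ξ := by
  unfold profile; split_ifs <;> rfl

theorem apply_profile₂ {X Y Z : Type*} (f : X → Y → Z) (a₁ b₁ a₃ s : ℝ) (p₁ p₃ : ℝ → X) (pR : X)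
    (r₁ r₃ : ℝ → Y) (rR : Y) (ξ : ℝ) :
    f (profile a₁ b₁ a₃ s p₁ p₃ pR ξ) (profile a₁ b₁ a₃ s r₁ r₃ rR ξ) =
      profile a₁ b₁ a₃ s (fun x => f (p₁ x) (r₁ x)) (fun x => f (p₃ x) (r₃ x)) (f pR rR) ξ := by
  unfold profile; split_ifs <;> rfl

section profile

variable {X : Type*} {a₁ b₁ a₃ s : ℝ} {p₁ p₃ : ℝ → X} {pR : X}

theorem profile_of_le (h₁ : a₁ ≤ b₁) (h : b₁ ≤ a₃) {ξ : ℝ} (hξ : ξ ≤ a₁) :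
    profile a₁ b₁ a₃ s p₁ p₃ pR ξ = p₁ a₁ := by
  rw [profile, if_pos (hξ.trans (h₁.trans h)), max_eq_left ((min_le_left _ _).trans hξ)]

theorem profile_of_mem_left (h : b₁ ≤ a₃) {ξ : ℝ} (hξ : ξ ∈ Icc a₁ b₁) :
    profile a₁ b₁ a₃ s p₁ p₃ pR ξ = p₁ ξ := by
  rw [profile, if_pos (hξ.2.trans h), min_eq_left hξ.2, max_eq_right hξ.1]

theorem profile_of_mem_middle (h₁ : a₁ ≤ b₁) {ξ : ℝ} (hξ : ξ ∈ Icc b₁ a₃) :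
    profile a₁ b₁ a₃ s p₁ p₃ pR ξ = p₁ b₁ := by
  rw [profile, if_pos hξ.2, min_eq_right hξ.1, max_eq_right h₁]

theorem profile_of_mem_right (h₁ : a₁ ≤ b₁) (h : b₁ ≤ a₃) (hp : p₁ b₁ = p₃ a₃) {ξ : ℝ}
    (hξ : ξ ∈ Icc a₃ s) : profile a₁ b₁ a₃ s p₁ p₃ pR ξ = p₃ ξ := by
  rcases hξ.1.eq_or_lt with rfl | h'
  · rw [profile_of_mem_middle h₁ ⟨h, le_rfl⟩, hp]
  · rw [profile, if_neg h'.not_ge, if_pos hξ.2]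

theorem profile_of_lt (h₃ : a₃ ≤ s) {ξ : ℝ} (hξ : s < ξ) :
    profile a₁ b₁ a₃ s p₁ p₃ pR ξ = pR := by
  rw [profile, if_neg (h₃.trans_lt hξ).not_ge, if_neg hξ.not_ge]

end profile

/-- Decomposition into a constant, two clamped ramps and a jump, to which the elementary balances
apply; matching at the middle state makes the pieces telescope. -/
theorem profile_eq_add {a₁ b₁ a₃ s : ℝ} (h₁ : a₁ ≤ b₁) (h : b₁ ≤ a₃) (h₃ : a₃ ≤ s)
    {f₁ f₃ : ℝ → ℝ} (hf : f₁ b₁ = f₃ a₃) (fR ξ : ℝ) :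
    profile a₁ b₁ a₃ s f₁ f₃ fR ξ = f₁ a₁ + (f₁ (max a₁ (min ξ b₁)) - f₁ a₁) +
      (f₃ (max a₃ (min ξ s)) - f₃ a₃) + (if s < ξ then fR - f₃ s else 0) := by
  rcases le_or_gt ξ a₃ with h' | h'
  · rw [profile, if_pos h', if_neg (h'.trans h₃).not_gt, max_eq_left ((min_le_left _ _).trans h')]
    ring
  · rw [min_eq_right (h.trans h'.le), max_eq_right h₁]
    rcases le_or_gt ξ s with h'' | h''
    · rw [profile, if_neg h'.not_ge, if_pos h'', if_neg h''.not_gt, min_eq_left h'',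
        max_eq_right h'.le, hf]
      ring
    · rw [profile, if_neg h'.not_ge, if_neg h''.not_ge, if_pos h'', min_eq_right h''.le,
        max_eq_right h₃, hf]
      ring

theorem Balance.profile {a₁ b₁ a₃ s : ℝ} (h₁ : a₁ ≤ b₁) (h : b₁ ≤ a₃) (h₃ : a₃ ≤ s)
    {f₁ f₁' g₁ f₃ f₃' g₃ : ℝ → ℝ}
    (hf₁ : ∀ r ∈ Icc a₁ b₁, HasDerivAt f₁ (f₁' r) r)
    (hg₁ : ∀ r ∈ Icc a₁ b₁, HasDerivAt g₁ (r * f₁' r) r) (hf₁' : ContinuousOn f₁' (Icc a₁ b₁))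
    (hf₃ : ∀ r ∈ Icc a₃ s, HasDerivAt f₃ (f₃' r) r)
    (hg₃ : ∀ r ∈ Icc a₃ s, HasDerivAt g₃ (r * f₃' r) r) (hf₃' : ContinuousOn f₃' (Icc a₃ s))
    (hf : f₁ b₁ = f₃ a₃) (hg : g₁ b₁ = g₃ a₃) (fR gR : ℝ) :
    Balance (Kerr.profile a₁ b₁ a₃ s f₁ f₃ fR) (Kerr.profile a₁ b₁ a₃ s g₁ g₃ gR) (f₁ a₁) fR s
      (-s * (fR - f₃ s) + (gR - g₃ s)) := by
  convert (((Balance.const (f₁ a₁) (g₁ a₁) s).add (Balance.ramp h₁ hf₁ hg₁ hf₁' s)).add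
    (Balance.ramp h₃ hf₃ hg₃ hf₃' s)).add (Balance.jump (fR - f₃ s) (gR - g₃ s) s) using 1
  · ext ξ; exact profile_eq_add h₁ h h₃ hf fR ξ
  · ext ξ; exact profile_eq_add h₁ h h₃ hg gR ξ
  · ring
  · rw [hf]; ring
  · ring

/-! ### Simple waves of the TM system in the direction `e₁` -/

/-- Profiles `e`, `H` on `[a, b]`, with derivatives `e'`, `H'`, forming a centred simple wave. -/
structure SimpleWave (M : Medium) (e e' H H' : ℝ → ℝ) (a b : ℝ) : Prop where
  deriv_e : ∀ ξ ∈ Icc a b, HasDerivAt e (e' ξ) ξ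
  deriv_H : ∀ ξ ∈ Icc a b, HasDerivAt H (H' ξ) ξ
  cont_e' : ContinuousOn e' (Icc a b)
  cont_H' : ContinuousOn H' (Icc a b)
  electric : ∀ ξ ∈ Icc a b, ξ * (M.ε₀ * (1 + 3 * M.εr * e ξ ^ 2) * e' ξ) = H' ξ
  magnetic : ∀ ξ ∈ Icc a b, ξ * H' ξ = M.μ₀⁻¹ * e' ξ

namespace SimpleWave

variable {M : Medium} {e e' H H' : ℝ → ℝ} {a b : ℝ}

theorem cont_e (h : SimpleWave M e e' H H' a b) : ContinuousOn e (Icc a b) :=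
  fun ξ hξ => (h.deriv_e ξ hξ).continuousAt.continuousWithinAt

theorem cont_H (h : SimpleWave M e e' H H' a b) : ContinuousOn H (Icc a b) :=
  fun ξ hξ => (h.deriv_H ξ hξ).continuousAt.continuousWithinAt

theorem deriv_q (h : SimpleWave M e e' H H' a b) : ∀ ξ ∈ Icc a b,
    HasDerivAt (fun r => M.q (e r)) (M.ε₀ * (1 + 3 * M.εr * e ξ ^ 2) * e' ξ) ξ := fun ξ hξ => by
  have h1 := h.deriv_e ξ hξ
  refine ((h1.add ((h1.pow 3).const_mul M.εr)).const_mul M.ε₀).congr_deriv ?_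
  simp only [Nat.cast_ofNat]
  ring

theorem deriv_energy (h : SimpleWave M e e' H H' a b) : ∀ ξ ∈ Icc a b,
    HasDerivAt (fun r => M.energy (e r) (H r))
      (M.ε₀ * (1 + 3 * M.εr * e ξ ^ 2) * e' ξ * e ξ + M.μ₀ * H ξ * H' ξ) ξ := fun ξ hξ => by
  have h1 := h.deriv_e ξ hξ
  have h2 := h.deriv_H ξ hξ
  refine ((((h1.pow 2).add ((h1.pow 4).const_mul (3 * M.εr / 2))).const_mul (M.ε₀ / 2)).add
    ((h2.pow 2).const_mul (M.μ₀ / 2))).congr_deriv ?_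
  simp only [Nat.cast_ofNat]
  ring

theorem cont_q' (h : SimpleWave M e e' H H' a b) :
    ContinuousOn (fun ξ => M.ε₀ * (1 + 3 * M.εr * e ξ ^ 2) * e' ξ) (Icc a b) :=
  (continuousOn_const.mul (continuousOn_const.add
    (continuousOn_const.mul (h.cont_e.pow 2)))).mul h.cont_e'

theorem cont_energy' (h : SimpleWave M e e' H H' a b) :
    ContinuousOn (fun ξ => M.ε₀ * (1 + 3 * M.εr * e ξ ^ 2) * e' ξ * e ξ + M.μ₀ * H ξ * H' ξ)
      (Icc a b) :=
  (h.cont_q'.mul h.cont_e).add ((continuousOn_const.mul h.cont_H).mul h.cont_H')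

theorem deriv_electric (h : SimpleWave M e e' H H' a b) : ∀ ξ ∈ Icc a b,
    HasDerivAt H (ξ * (M.ε₀ * (1 + 3 * M.εr * e ξ ^ 2) * e' ξ)) ξ := fun ξ hξ =>
  (h.deriv_H ξ hξ).congr_deriv (h.electric ξ hξ).symm

theorem deriv_magnetic (h : SimpleWave M e e' H H' a b) : ∀ ξ ∈ Icc a b,
    HasDerivAt (fun r => M.μ₀⁻¹ * e r) (ξ * H' ξ) ξ := fun ξ hξ =>
  ((h.deriv_e ξ hξ).const_mul _).congr_deriv (h.magnetic ξ hξ).symm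

/-- This is `Q' = ξ η'`: the gradient of the energy is `(E, μ₀ H)`, and pairing it with the
equations of the simple wave gives the flux. Hence rarefactions conserve energy. -/
theorem deriv_energyFlux (h : SimpleWave M e e' H H' a b) : ∀ ξ ∈ Icc a b,
    HasDerivAt (fun r => H r * e r)
      (ξ * (M.ε₀ * (1 + 3 * M.εr * e ξ ^ 2) * e' ξ * e ξ + M.μ₀ * H ξ * H' ξ)) ξ := fun ξ hξ => by
  have h1 := h.electric ξ hξ
  have h2 := h.magnetic ξ hξ
  have h3 : M.μ₀ * M.μ₀⁻¹ = 1 := mul_inv_cancel₀ M.μ₀_pos.ne'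
  refine ((h.deriv_H ξ hξ).mul (h.deriv_e ξ hξ)).congr_deriv ?_
  linear_combination (-e ξ) * h1 - M.μ₀ * H ξ * h2 - H ξ * e' ξ * h3

theorem isRarefaction (h : SimpleWave M e e' H H' a b) (hab : a < b) {lam : TMState → ℝ}
    {V : ℝ → TMState} (hV : ∀ ξ ∈ Icc a b, V ξ = M.state (e ξ) (H ξ))
    (hlam : ∀ ξ ∈ Icc a b, lam (M.state (e ξ) (H ξ)) = ξ) :
    IsRarefaction (dirFlux (tmFlux M) ![1, 0]) lam V a b (M.state (e a) (H a))
      (M.state (e b) (H b)) := by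
  have hd : ∀ {f g : ℝ → ℝ} {f' g' ξ : ℝ}, HasDerivAt f f' ξ → HasDerivAt g g' ξ →
      HasDerivAt (fun r => ((![0, f r], g r) : TMState)) (![0, f'], g') ξ := by
    intro f g f' g' ξ hf hg
    refine HasDerivAt.prodMk (hasDerivAt_pi.2 fun i => ?_) hg
    fin_cases i
    · exact hasDerivAt_const ξ (0 : ℝ)
    · exact hf
  refine ⟨hab, ?_, hV a ⟨le_rfl, hab.le⟩, hV b ⟨hab.le, le_rfl⟩,
    fun ξ hξ => by rw [hV ξ hξ, hlam ξ hξ], fun ξ hξ => ?_⟩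
  · refine ContinuousOn.congr (fun ξ hξ => ?_) hV
    exact (hd (h.deriv_q ξ hξ) (h.deriv_H ξ hξ)).continuousAt.continuousWithinAt
  · have hξ' := Ioo_subset_Icc_self hξ
    have hev : ∀ᶠ r in nhds ξ, V r = M.state (e r) (H r) := by
      filter_upwards [Ioo_mem_nhds hξ.1 hξ.2] with r hr using hV r (Ioo_subset_Icc_self hr)
    refine ⟨(![0, M.ε₀ * (1 + 3 * M.εr * e ξ ^ 2) * e' ξ], H' ξ),
      (hd (h.deriv_q ξ hξ') (h.deriv_H ξ hξ')).congr_of_eventuallyEq hev, ?_⟩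
    have h1 := hd (h.deriv_electric ξ hξ') (h.deriv_magnetic ξ hξ')
    refine (h1.congr_of_eventuallyEq ?_).congr_deriv (by simp)
    filter_upwards [hev] with r hr
    rw [hr, M.dirFlux_tmFlux_state]

end SimpleWave

/-- Two simple waves separated by a constant state, followed by a shock. -/
theorem TMBalance.profile {M : Medium} {e₁ e₁' H₁ H₁' e₃ e₃' H₃ H₃' : ℝ → ℝ}
    {a₁ b₁ a₃ s eR HR : ℝ} (hw₁ : SimpleWave M e₁ e₁' H₁ H₁' a₁ b₁)
    (hw₃ : SimpleWave M e₃ e₃' H₃ H₃' a₃ s) (h₁ : a₁ ≤ b₁) (h : b₁ ≤ a₃) (h₃ : a₃ ≤ s)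
    (he : e₁ b₁ = e₃ a₃) (hH : H₁ b₁ = H₃ a₃)
    (hs₁ : s * (M.q eR - M.q (e₃ s)) = HR - H₃ s)
    (hs₂ : s * (HR - H₃ s) = M.μ₀⁻¹ * (eR - e₃ s)) :
    TMBalance M (Kerr.profile a₁ b₁ a₃ s e₁ e₃ eR) (Kerr.profile a₁ b₁ a₃ s H₁ H₃ HR)
      (e₁ a₁) (H₁ a₁) eR HR s
      (-s * (M.energy eR HR - M.energy (e₃ s) (H₃ s)) + (HR * eR - H₃ s * e₃ s)) := by
  constructor
  · simp only [apply_profile M.q]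
    convert Balance.profile h₁ h h₃ hw₁.deriv_q hw₁.deriv_electric hw₁.cont_q' hw₃.deriv_q
      hw₃.deriv_electric hw₃.cont_q' (by rw [he]) hH (M.q eR) HR using 1
    linear_combination hs₁
  · simp only [apply_profile (fun x => M.μ₀⁻¹ * x)]
    convert Balance.profile h₁ h h₃ hw₁.deriv_H hw₁.deriv_magnetic hw₁.cont_H' hw₃.deriv_H
      hw₃.deriv_magnetic hw₃.cont_H' hH (by rw [he]) HR (M.μ₀⁻¹ * eR) using 1
    linear_combination hs₂
  · simp only [apply_profile₂ M.energy, apply_profile₂ (fun x y : ℝ => x * y)]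
    exact Balance.profile h₁ h h₃ hw₁.deriv_energy hw₁.deriv_energyFlux hw₁.cont_energy'
      hw₃.deriv_energy hw₃.deriv_energyFlux hw₃.cont_energy' (by rw [he, hH]) (by rw [he, hH]) _ _

/-- A single discontinuity. -/
theorem TMBalance.shock {M : Medium} {eL HL eR HR s : ℝ}
    (hs₁ : s * (M.q eR - M.q eL) = HR - HL) (hs₂ : s * (HR - HL) = M.μ₀⁻¹ * (eR - eL)) :
    TMBalance M (fun ξ => if s < ξ then eR else eL) (fun ξ => if s < ξ then HR else HL)
      eL HL eR HR s (-s * (M.energy eR HR - M.energy eL HL) + (HR * eR - HL * eL)) := by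
  constructor
  · simp only [apply_ite M.q]
    convert Balance.shock (M.q eL) (M.q eR) HL HR s using 1
    linear_combination hs₁
  · simp only [apply_ite (fun x => M.μ₀⁻¹ * x)]
    convert Balance.shock HL HR (M.μ₀⁻¹ * eL) (M.μ₀⁻¹ * eR) s using 1
    linear_combination hs₂
  · convert Balance.shock (M.energy eL HL) (M.energy eR HR) (HL * eL) (HR * eR) s using 1
    · ext ξ; split_ifs <;> rfl
    · ext ξ; split_ifs <;> rfl

/-- The energy production of a discontinuity satisfying the Rankine-Hugoniot conditions. -/
theorem energy_production {M : Medium} {eL HL eR HR s : ℝ}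
    (hs₁ : s * (M.q eR - M.q eL) = HR - HL) (hs₂ : s * (HR - HL) = M.μ₀⁻¹ * (eR - eL)) :
    -s * (M.energy eR HR - M.energy eL HL) + (HR * eR - HL * eL) =
      -s * (M.ε₀ * M.εr / 4 * (eR ^ 2 - eL ^ 2) * (eR - eL) ^ 2) := by
  have h3 : M.μ₀ * M.μ₀⁻¹ = 1 := mul_inv_cancel₀ M.μ₀_pos.ne'
  unfold Medium.q at hs₁
  unfold Medium.energy
  -- Multiplying the jump relations by the mean values of `e` and `H` removes the magnetic part and
  -- leaves `s` times the trapezoidal rule for `∫ e dq` minus the integral itself; for a cubic `q`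
  -- this error is explicit.
  linear_combination (-(eR + eL) / 2) * hs₁ - M.μ₀ * (HR + HL) / 2 * hs₂ -
    (HR + HL) / 2 * (eR - eL) * h3

/-! ### Characteristic speeds, the wave curve `Φ` and the middle state -/

namespace Medium

variable (M : Medium)

theorem c_pos : 0 < M.c := by
  have := M.ε₀_pos
  have := M.μ₀_pos
  unfold c
  positivity

theorem c_sq_mul : M.c ^ 2 * M.ε₀ = M.μ₀⁻¹ := by
  have h0 := M.ε₀_pos
  have h1 := M.μ₀_pos
  rw [c, inv_pow, Real.sq_sqrt (by positivity)]
  field_simp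

theorem q_strictMono : StrictMono M.q := by
  have h0 := M.ε₀_pos
  have h1 := M.εr_pos
  intro x y hxy
  have h3 : x ^ 3 < y ^ 3 := (Odd.strictMono_pow (by decide)) hxy
  have h4 : M.εr * x ^ 3 < M.εr * y ^ 3 := mul_lt_mul_of_pos_left h3 h1
  exact mul_lt_mul_of_pos_left (add_lt_add hxy h4) h0

theorem q_sub (x y : ℝ) :
    M.q x - M.q y = M.ε₀ * (1 + M.εr * (x ^ 2 + x * y + y ^ 2)) * (x - y) := by
  unfold q; ring

theorem speed_pos (e : ℝ) : 0 < M.speed e :=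
  div_pos M.c_pos (Real.sqrt_pos.2 (M.one_add_pos (by norm_num) e))

theorem speed_sq_mul (e : ℝ) : M.speed e ^ 2 * (M.ε₀ * (1 + 3 * M.εr * e ^ 2)) = M.μ₀⁻¹ := by
  have h := M.one_add_pos (by norm_num : (0 : ℝ) ≤ 3) e
  rw [speed, div_pow, Real.sq_sqrt h.le, ← M.c_sq_mul]
  field_simp

theorem speed_lt_speed {x y : ℝ} (h : x ^ 2 < y ^ 2) : M.speed y < M.speed x := by
  have h1 := M.one_add_pos (by norm_num : (0 : ℝ) ≤ 3) x
  have h2 := M.εr_pos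
  exact div_lt_div_of_pos_left M.c_pos (Real.sqrt_pos.2 h1)
    (Real.sqrt_lt_sqrt h1.le (by gcongr))

theorem speed_lt_c {e : ℝ} (h : e ≠ 0) : M.speed e < M.c := by
  have := M.speed_lt_speed (x := 0) (y := e)
    (by rw [zero_pow two_ne_zero]; exact sq_pos_of_ne_zero h)
  simpa [speed] using this

/-- `Φ(e) = ∫ λ dD`, the change of `H₃` along a simple wave. -/
def phi (e : ℝ) : ℝ := M.c * M.ε₀ * ∫ x in (0 : ℝ)..e, √(1 + 3 * M.εr * x ^ 2)

theorem hasDerivAt_phi (e : ℝ) :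
    HasDerivAt M.phi (M.c * M.ε₀ * √(1 + 3 * M.εr * e ^ 2)) e := by
  have hc : Continuous fun x : ℝ => √(1 + 3 * M.εr * x ^ 2) := by fun_prop
  exact (intervalIntegral.integral_hasDerivAt_right (hc.intervalIntegrable _ _)
    hc.aestronglyMeasurable.stronglyMeasurableAtFilter hc.continuousAt).const_mul _

theorem continuous_phi : Continuous M.phi :=
  continuous_iff_continuousAt.2 fun e => (M.hasDerivAt_phi e).continuousAt

theorem phi_neg (e : ℝ) : M.phi (-e) = -M.phi e := by
  have := intervalIntegral.integral_comp_neg (a := 0) (b := e)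
    fun x : ℝ => √(1 + 3 * M.εr * x ^ 2)
  simp only [neg_sq, neg_zero] at this
  rw [phi, phi, this, intervalIntegral.integral_symm]
  ring

theorem phi_sub (x y : ℝ) :
    M.phi y - M.phi x = M.c * M.ε₀ * ∫ t in x..y, √(1 + 3 * M.εr * t ^ 2) := by
  have hc : Continuous fun x : ℝ => √(1 + 3 * M.εr * x ^ 2) := by fun_prop
  rw [phi, phi, ← mul_sub, intervalIntegral.integral_interval_sub_left
    (hc.intervalIntegrable _ _) (hc.intervalIntegrable _ _)]

/-- The integrand is at least `1`. This linear growth lets the intermediate value theorem reach any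
level of `Φ`. -/
theorem mul_le_phi {e : ℝ} (he : 0 ≤ e) : M.c * M.ε₀ * e ≤ M.phi e := by
  have hc : Continuous fun x : ℝ => √(1 + 3 * M.εr * x ^ 2) := by fun_prop
  have h1 := M.εr_pos
  have h2 := mul_pos M.c_pos M.ε₀_pos
  refine mul_le_mul_of_nonneg_left ?_ h2.le
  calc e = ∫ _ in (0 : ℝ)..e, (1 : ℝ) := by simp
    _ ≤ _ := intervalIntegral.integral_mono_on he (by simp) (hc.intervalIntegrable _ _)
      fun x _ => Real.one_le_sqrt.2 (by nlinarith [sq_nonneg x])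

/-- The concave square root lies below its tangent at `A`. -/
theorem sqrt_le_tangent {A X : ℝ} (hA : 0 < A) (hX : 0 ≤ X) : √X ≤ (X + A) / (2 * √A) := by
  rw [le_div_iff₀ (by positivity)]
  nlinarith [sq_nonneg (√X - √A), Real.sq_sqrt hX, Real.sq_sqrt hA.le]

theorem sqrt_lt_tangent {A X : ℝ} (hA : 0 < A) (hX : 0 ≤ X) (h : X ≠ A) :
    √X < (X + A) / (2 * √A) := by
  have : √X - √A ≠ 0 := fun h' => h ((Real.sqrt_inj hX hA.le).1 (sub_eq_zero.1 h'))
  rw [lt_div_iff₀ (by positivity)]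
  nlinarith [sq_pos_of_ne_zero this, Real.sq_sqrt hX, Real.sq_sqrt hA.le]

/-- The inequality that makes the intermediate state of the TM solution lie on the
`1`-rarefaction branch. -/
theorem phi_sub_phi_half_lt {E : ℝ} (hE : 0 < E) :
    M.phi E - M.phi (E / 2) + M.speed (E / 2) * (M.q E + M.q (E / 2)) <
      2 * (M.c / √(1 + M.εr * E ^ 2)) * M.q E := by
  have h0 := M.ε₀_pos
  have h1 := M.εr_pos
  have hc := M.c_pos
  -- In units of `ε₀`, `A` is the mean slope of `q` on `[-E, E]`, and `B` is the slope at `E / 2`,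
  -- which is also that of the tangent chord over `[-E, E / 2]`. The two differ, whence the strict
  -- inequality.
  set A := 1 + M.εr * E ^ 2 with hA
  set B := 1 + 3 * M.εr * (E / 2) ^ 2 with hB
  have hA0 : 0 < A := by positivity
  have hB0 : 0 < B := by positivity
  have hAB : B ≠ A := by
    intro h
    have : 0 < M.εr * E ^ 2 := by positivity
    rw [hA, hB] at h
    nlinarith
  have hsA : 0 < √A := Real.sqrt_pos.2 hA0
  have hsB : 0 < √B := Real.sqrt_pos.2 hB0
  have hsA2 : √A ^ 2 = A := Real.sq_sqrt hA0.le
  have hsB2 : √B ^ 2 = B := Real.sq_sqrt hB0.le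
  have hint : ∫ t in (E / 2)..E, √(1 + 3 * M.εr * t ^ 2) ≤
      ((E / 2) * (1 + A) + M.εr * (7 / 8 * E ^ 3)) / (2 * √A) := by
    have hcc : Continuous fun x : ℝ => √(1 + 3 * M.εr * x ^ 2) := by fun_prop
    have hcd : Continuous fun x : ℝ => (1 + 3 * M.εr * x ^ 2 + A) / (2 * √A) := by fun_prop
    refine (intervalIntegral.integral_mono_on (by linarith) (hcc.intervalIntegrable _ _)
      (hcd.intervalIntegrable _ _) fun x _ => sqrt_le_tangent hA0
        (M.one_add_pos (by norm_num) x).le).trans (le_of_eq ?_)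
    have hd : ∀ x ∈ uIcc (E / 2) E, HasDerivAt
        (fun x : ℝ => (x * (1 + A) + M.εr * x ^ 3) / (2 * √A))
        ((1 + 3 * M.εr * x ^ 2 + A) / (2 * √A)) x := fun x _ => by
      refine ((((hasDerivAt_id' x).mul_const (1 + A)).add
        ((hasDerivAt_pow 3 x).const_mul M.εr)).div_const (2 * √A)).congr_deriv ?_
      push_cast
      ring
    rw [intervalIntegral.integral_eq_sub_of_hasDerivAt hd (hcd.intervalIntegrable _ _)]
    ring
  have hB' : √B < (B + A) / (2 * √A) := sqrt_lt_tangent hA0 hB0.le hAB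
  -- Tangency: the chord over `[-E, E / 2]`, of length `3 E / 2`, has slope `ε₀ B`.
  have e1 : M.speed (E / 2) * (M.q E + M.q (E / 2)) = M.c * M.ε₀ * (3 / 2 * E * √B) := by
    have : M.q E + M.q (E / 2) = M.ε₀ * (3 / 2 * E * √B ^ 2) := by
      rw [hsB2, hB]; unfold q; ring
    rw [this, speed, ← hB]
    field_simp
  have e2 : 2 * (M.c / √A) * M.q E = M.c * M.ε₀ * (2 * E * √A) := by
    have : M.q E = M.ε₀ * √A ^ 2 * E := by rw [hsA2, q_eq]
    rw [this]
    field_simp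
  rw [phi_sub, e1, e2, ← mul_add]
  refine mul_lt_mul_of_pos_left ?_ (mul_pos hc h0)
  calc _ < ((E / 2) * (1 + A) + M.εr * (7 / 8 * E ^ 3)) / (2 * √A) +
        3 / 2 * E * ((B + A) / (2 * √A)) :=
        add_lt_add_of_le_of_lt hint (mul_lt_mul_of_pos_left hB' (by positivity))
    -- The tangent bounds add up exactly because the slopes over the arc and the chord have mean
    -- `A`.
    _ = (4 * E * A) / (2 * √A) := by rw [← mul_div_assoc, ← add_div, hA, hB]; ring
    _ = 2 * E * √A := by rw [← hsA2]; field_simp; norm_num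

/-- The equation is what remains of the two wave curves and the first jump relation after `H` has
been eliminated. The Jensen inequality says that its right-hand side exceeds `2 Φ(E)`, so the root
lies beyond `E`. -/
theorem exists_middle_field {E : ℝ} (hE : 0 < E) : ∃ E₁, E < E₁ ∧
    2 * M.phi E₁ = M.phi E + M.phi (E / 2) + 2 * (M.c / √(1 + M.εr * E ^ 2)) * M.q E -
      M.speed (E / 2) * (M.q E + M.q (E / 2)) := by
  have h := M.phi_sub_phi_half_lt hE
  have h2 := mul_pos M.c_pos M.ε₀_pos
  set T := (M.phi E + M.phi (E / 2) + 2 * (M.c / √(1 + M.εr * E ^ 2)) * M.q E -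
    M.speed (E / 2) * (M.q E + M.q (E / 2))) / 2 with hT
  have hET : M.phi E < T := by rw [hT]; linarith
  have hb : T ≤ M.phi (max E (T / (M.c * M.ε₀))) := by
    refine le_trans ?_ (M.mul_le_phi (hE.le.trans (le_max_left _ _)))
    calc T = M.c * M.ε₀ * (T / (M.c * M.ε₀)) := by
          rw [mul_div_assoc', mul_div_cancel_left₀ _ h2.ne']
      _ ≤ _ := mul_le_mul_of_nonneg_left (le_max_right _ _) h2.le
  obtain ⟨E₁, hE₁, hE₁'⟩ := intermediate_value_Icc (le_max_left E (T / (M.c * M.ε₀)))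
    M.continuous_phi.continuousOn ⟨hET.le, hb⟩
  refine ⟨E₁, hE₁.1.lt_of_ne ?_, by rw [hE₁', hT]; ring⟩
  rintro rfl
  exact hET.ne hE₁'

/-! ### Rarefaction profiles -/

/-- The field strength `|e|` at which the characteristic speed is `|ξ|`. -/
def fieldAt (ξ : ℝ) : ℝ := √((M.c ^ 2 / ξ ^ 2 - 1) / (3 * M.εr))

/-- The derivative of `fieldAt`. -/
def fieldAt' (ξ : ℝ) : ℝ :=
  (M.c ^ 2 * (-2 / ξ ^ 3)) / (3 * M.εr) / (2 * M.fieldAt ξ)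

theorem fieldAt_pos {ξ : ℝ} (h0 : ξ ≠ 0) (h : |ξ| < M.c) : 0 < M.fieldAt ξ := by
  have h1 := M.εr_pos
  have h2 : ξ ^ 2 < M.c ^ 2 := by
    rw [← sq_abs ξ]; exact pow_lt_pow_left₀ h (abs_nonneg ξ) two_ne_zero
  have h3 : 1 < M.c ^ 2 / ξ ^ 2 := (one_lt_div (by positivity)).2 h2
  exact Real.sqrt_pos.2 (div_pos (by linarith) (by positivity))

theorem one_add_fieldAt {ξ : ℝ} (h0 : ξ ≠ 0) (h : |ξ| < M.c) :
    1 + 3 * M.εr * M.fieldAt ξ ^ 2 = M.c ^ 2 / ξ ^ 2 := by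
  have h1 := M.εr_pos
  rw [fieldAt, Real.sq_sqrt (Real.sqrt_pos.1 (M.fieldAt_pos h0 h)).le]
  field_simp
  ring

theorem hasDerivAt_fieldAt {ξ : ℝ} (h0 : ξ ≠ 0) (h : |ξ| < M.c) :
    HasDerivAt M.fieldAt (M.fieldAt' ξ) ξ := by
  have h1 : HasDerivAt (fun x : ℝ => (M.c ^ 2 / x ^ 2 - 1) / (3 * M.εr))
      ((M.c ^ 2 * (-2 / ξ ^ 3)) / (3 * M.εr)) ξ := by
    have h2 := (((hasDerivAt_pow 2 ξ).fun_inv (pow_ne_zero 2 h0)).const_mul (M.c ^ 2)).sub_const 1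
    refine (h2.div_const (3 * M.εr)).congr_deriv ?_
    field_simp
    norm_num
    ring
  exact h1.sqrt (Real.sqrt_pos.1 (M.fieldAt_pos h0 h)).ne'

theorem speed_mul_fieldAt {κ ξ : ℝ} (hκ : κ ^ 2 = 1) (h0 : ξ ≠ 0) (h : |ξ| < M.c) :
    M.speed (κ * M.fieldAt ξ) = |ξ| := by
  have hc := M.c_pos
  rw [speed, mul_pow, hκ, one_mul, M.one_add_fieldAt h0 h, ← div_pow,
    Real.sqrt_sq_eq_abs, abs_div, abs_of_pos hc]
  field_simp

theorem fieldAt_speed {E : ℝ} (hE : 0 ≤ E) : M.fieldAt (M.speed E) = E := by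
  have h1 := M.εr_pos
  have hc := M.c_pos
  have h := M.one_add_pos (by norm_num : (0 : ℝ) ≤ 3) E
  rw [fieldAt, speed, div_pow, Real.sq_sqrt h.le]
  have : (M.c ^ 2 / (M.c ^ 2 / (1 + 3 * M.εr * E ^ 2)) - 1) / (3 * M.εr) = E ^ 2 := by
    field_simp
    ring
  rw [this, Real.sqrt_sq hE]

theorem fieldAt_neg (ξ : ℝ) : M.fieldAt (-ξ) = M.fieldAt ξ := by simp [fieldAt]

/-- The rarefaction waves: `e = κ |e|`, `H = C + τ Φ(e)`, with `τ` the sign of the speed. -/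
theorem simpleWave {κ τ : ℝ} (hκ : κ ^ 2 = 1) (hτ : τ ^ 2 = 1) (C : ℝ) {a b : ℝ}
    (h : ∀ ξ ∈ Icc a b, 0 < τ * ξ ∧ τ * ξ < M.c) :
    SimpleWave M (fun ξ => κ * M.fieldAt ξ) (fun ξ => κ * M.fieldAt' ξ)
      (fun ξ => C + τ * M.phi (κ * M.fieldAt ξ)) (fun ξ => M.μ₀⁻¹ * (κ * M.fieldAt' ξ) / ξ)
      a b := by
  -- The range `0 < |ξ| < c` keeps the wave away from `e = 0`, where the speed is `c` and `fieldAt`,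
  -- a square root, is not differentiable.
  have h0 : ∀ ξ ∈ Icc a b, ξ ≠ 0 := fun ξ hξ h' => by
    have := (h ξ hξ).1
    rw [h', mul_zero] at this
    exact this.false
  have habs : ∀ ξ ∈ Icc a b, |ξ| = τ * ξ := fun ξ hξ => by
    have : |τ| = 1 := by
      rw [← Real.sqrt_sq_eq_abs, hτ, Real.sqrt_one]
    rw [← abs_of_pos (h ξ hξ).1, abs_mul, this, one_mul]
  have hlt : ∀ ξ ∈ Icc a b, |ξ| < M.c := fun ξ hξ => by rw [habs ξ hξ]; exact (h ξ hξ).2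
  have hd : ∀ ξ ∈ Icc a b, HasDerivAt (fun ξ => κ * M.fieldAt ξ) (κ * M.fieldAt' ξ) ξ :=
    fun ξ hξ => (M.hasDerivAt_fieldAt (h0 ξ hξ) (hlt ξ hξ)).const_mul κ
  have hc' : ContinuousOn M.fieldAt' (Icc a b) := by
    have hcf : ContinuousOn M.fieldAt (Icc a b) := fun ξ hξ =>
      (M.hasDerivAt_fieldAt (h0 ξ hξ) (hlt ξ hξ)).continuousAt.continuousWithinAt
    refine ContinuousOn.div (ContinuousOn.div_const (continuousOn_const.mul
      (continuousOn_const.div (continuousOn_id.pow 3) fun ξ hξ => pow_ne_zero 3 (h0 ξ hξ))) _)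
      (continuousOn_const.mul hcf) fun ξ hξ => ?_
    exact mul_ne_zero two_ne_zero (M.fieldAt_pos (h0 ξ hξ) (hlt ξ hξ)).ne'
  have hc := M.c_pos
  refine ⟨hd, fun ξ hξ => ?_, continuousOn_const.mul hc', ?_, fun ξ hξ => ?_, fun ξ hξ => ?_⟩
  · have h1 := (((M.hasDerivAt_phi _).comp ξ (hd ξ hξ)).const_mul τ).const_add C
    refine h1.congr_deriv ?_
    have hξ0 := h0 ξ hξ
    have hτ0 : τ ≠ 0 := fun h => by simp [h] at hτ
    rw [mul_pow, hκ, one_mul, M.one_add_fieldAt hξ0 (hlt ξ hξ), ← div_pow, Real.sqrt_sq_eq_abs,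
      abs_div, abs_of_pos hc, habs ξ hξ, ← M.c_sq_mul]
    field_simp
  · exact (continuousOn_const.mul (continuousOn_const.mul hc')).div continuousOn_id h0
  · have hξ0 := h0 ξ hξ
    rw [mul_pow, hκ, one_mul, M.one_add_fieldAt hξ0 (hlt ξ hξ), ← M.c_sq_mul]
    field_simp
  · have hξ0 := h0 ξ hξ
    field_simp

end Medium

/-! ### Liu's condition, the plane integral and distinctness -/

theorem rankineHugoniot_state_iff {M : Medium} {τ eL HL eR HR : ℝ} :
    RankineHugoniot (dirFlux (tmFlux M) ![1, 0]) τ (M.state eL HL) (M.state eR HR) ↔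
      τ * (M.q eR - M.q eL) = HR - HL ∧ τ * (HR - HL) = M.μ₀⁻¹ * (eR - eL) := by
  rw [RankineHugoniot, M.dirFlux_tmFlux_state, M.dirFlux_tmFlux_state]
  simp [Medium.state, mul_sub]

/-- The shock whose speed is characteristic on the left satisfies Liu's condition. -/
theorem isLiuAdmissible_of_half {M : Medium} {κ E HL HR : ℝ} (hκ : κ ^ 2 = 1) (hE : 0 < E)
    (hs₁ : M.speed (E / 2) * (M.q (-(κ * E)) - M.q (κ * (E / 2))) = HR - HL)
    (hs₂ : M.speed (E / 2) * (HR - HL) = M.μ₀⁻¹ * (-(κ * E) - κ * (E / 2))) :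
    IsLiuAdmissible M ![1, 0] (M.speed (E / 2)) (M.state (κ * (E / 2)) HL)
      (M.state (-(κ * E)) HR) := by
  refine ⟨rankineHugoniot_state_iff.2 ⟨hs₁, hs₂⟩, ?_⟩
  rintro ⟨D, H⟩ τ hτ hpos ⟨θ, hθ, hD⟩
  have hs := M.speed_pos (E / 2)
  have hτ0 : 0 < τ := (mul_pos_iff_of_pos_left hs).1 hpos
  -- Describe the competing state by its electric field `κ g`; as `q` is odd, the sign `κ` then
  -- factors out.
  obtain ⟨g, hg⟩ : ∃ g, M.q (κ * g) = D 1 := ⟨κ * M.p (D 1), by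
    rw [← mul_assoc, ← sq, hκ, one_mul, M.q_p]⟩
  have hD0 : D 0 = 0 := by simpa [Medium.state] using congrFun hD 0
  have hD1 : D 1 = M.q (κ * (E / 2)) + θ * (M.q (-(κ * E)) - M.q (κ * (E / 2))) := by
    simpa [Medium.state] using congrFun hD 1
  have hst : ((D, H) : TMState) = M.state (κ * g) H := by
    refine Prod.ext (funext fun i => ?_) rfl
    fin_cases i
    · exact hD0
    · exact hg.symm
  rw [hst, rankineHugoniot_state_iff] at hτ
  obtain ⟨h1, h2⟩ := hτ
  have hqκ : ∀ x, M.q (κ * x) = κ * M.q x := fun x => by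
    unfold Medium.q
    linear_combination M.ε₀ * M.εr * κ * x ^ 3 * hκ
  have hκ0 : κ ≠ 0 := fun h => by simp [h] at hκ
  have hqg : M.q g = M.q (E / 2) + θ * (M.q (-E) - M.q (E / 2)) := by
    rw [← hg, ← mul_neg, hqκ, hqκ, hqκ] at hD1
    refine mul_left_cancel₀ hκ0 ?_
    linear_combination hD1
  have hlt : M.q (-E) < M.q (E / 2) := M.q_strictMono (by linarith)
  have hg1 : g < E / 2 := M.q_strictMono.lt_iff_lt.1 (by nlinarith [hθ.1])
  have hg2 : -E ≤ g := M.q_strictMono.le_iff_le.1 (by nlinarith [hθ.2])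
  -- Eliminating `H`, the squared speed times the chord slope of `q` is `μ₀⁻¹`. Division by `g - E /
  -- 2` is possible because `θ > 0`.
  have hτ2 : τ ^ 2 * (M.ε₀ * (1 + M.εr * (g ^ 2 + g * (E / 2) + (E / 2) ^ 2))) = M.μ₀⁻¹ := by
    have hne : κ * (g - E / 2) ≠ 0 := mul_ne_zero hκ0 (sub_ne_zero.2 hg1.ne)
    refine mul_right_cancel₀ hne ?_
    rw [hqκ, hqκ] at h1
    have h3 := M.q_sub g (E / 2)
    linear_combination h2 + τ * h1 - τ ^ 2 * κ * h3
  have hs2 := M.speed_sq_mul (E / 2)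
  -- The difference of the two sides is `(g + E) (g - E / 2)`, which is nonpositive for `-E ≤ g < E
  -- / 2`. A flatter chord of `q` means a faster shock.
  have hle : g ^ 2 + g * (E / 2) + (E / 2) ^ 2 ≤ 3 * (E / 2) ^ 2 := by nlinarith
  have hr := M.εr_pos
  have he := M.ε₀_pos
  have hle' : M.ε₀ * (1 + M.εr * (g ^ 2 + g * (E / 2) + (E / 2) ^ 2)) ≤
      M.ε₀ * (1 + 3 * M.εr * (E / 2) ^ 2) := by
    refine mul_le_mul_of_nonneg_left ?_ he.le
    nlinarith
  have hY : 0 < M.ε₀ * (1 + 3 * M.εr * (E / 2) ^ 2) := by positivity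
  by_contra! hlt'
  have : τ ^ 2 < M.speed (E / 2) ^ 2 := pow_lt_pow_left₀ hlt' hτ0.le two_ne_zero
  nlinarith [mul_lt_mul_of_pos_right this hY, mul_le_mul_of_nonneg_left hle' (sq_nonneg τ)]

theorem continuous_planePoint (s : ℝ) :
    Continuous fun z : ℝ × ℝ => ((z.1, ![s * z.1, z.2]) : SpaceTime 2) := by
  refine continuous_fst.prodMk (continuous_pi fun i => ?_)
  fin_cases i
  · exact continuous_const.mul continuous_fst
  · exact continuous_snd

theorem IsTest.integrable_plane {φ : SpaceTime 2 → ℝ} (hφ : IsTest φ) (s : ℝ) :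
    Integrable fun z : ℝ × ℝ => φ (z.1, ![s * z.1, z.2]) := by
  refine Continuous.integrable_of_hasCompactSupport
    (hφ.1.continuous.comp (continuous_planePoint s)) ?_
  exact hφ.hasCompactSupport_comp (Function.LeftInverse.isClosedEmbedding
    (f := fun z : SpaceTime 2 => (z.1, z.2 1)) (fun z => by simp) (by fun_prop)
    (continuous_planePoint s))

theorem planeIntegral_eq {φ : SpaceTime 2 → ℝ} (hφ : IsTest φ) (s : ℝ) :
    planeIntegral s φ =
      ∫ z in Ioi (0 : ℝ) ×ˢ (univ : Set ℝ), φ (z.1, ![s * z.1, z.2]) := by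
  rw [Measure.volume_eq_prod, setIntegral_prod _ (hφ.integrable_plane s).integrableOn]
  unfold planeIntegral
  congr 1
  ext t
  have h := (volume_preserving_funUnique (Fin 1) ℝ).symm.integral_comp
    (MeasurableEquiv.measurableEmbedding _) fun y => φ (t, Fin.cons (s * t) y)
  rw [Measure.restrict_univ]
  refine Eq.trans ?_ (h.symm.trans ?_)
  · congr!
  congr 1
  ext x
  congr 2
  ext i
  fin_cases i <;> rfl

theorem exists_planeIntegral_pos (s : ℝ) :
    ∃ φ : SpaceTime 2 → ℝ, IsTest φ ∧ 0 < planeIntegral s φ := by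
  let b : ContDiffBump ((1, ![s * 1, 0]) : SpaceTime 2) := ⟨1, 2, one_pos, one_lt_two⟩
  have hφ : IsTest b := ⟨b.contDiff, b.hasCompactSupport⟩
  refine ⟨b, hφ, ?_⟩
  rw [planeIntegral_eq hφ, setIntegral_pos_iff_support_of_nonneg_ae
    (ae_of_all _ fun z => b.nonneg) (hφ.integrable_plane s).integrableOn]
  refine IsOpen.measure_pos _ (IsOpen.inter ?_ (isOpen_Ioi.prod isOpen_univ)) ⟨(1, 0), ?_, ?_⟩
  · exact (hφ.1.continuous.comp (continuous_planePoint s)).isOpen_support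
  · have : b (1, ![s * 1, 0]) = 1 :=
      b.one_of_mem_closedBall (Metric.mem_closedBall_self zero_le_one)
    rw [Function.mem_support, this]
    exact one_ne_zero
  · exact ⟨mem_Ioi.2 one_pos, mem_univ _⟩

/-- The profiles then differ on the nonempty open cone `a t < x₀ < b t`, which has positive measure.
-/
theorem not_ae_eq_selfSimilar {X : Type*} {V W : ℝ → X} {a b : ℝ} (hab : a < b)
    (h : ∀ ξ ∈ Ioo a b, V ξ ≠ W ξ) {n : ℕ} {ω : Fin (n + 1) → ℝ} (hω : ω = Pi.single 0 1) :
    ¬ selfSimilar ω V =ᵐ[volume.restrict (future (n + 1))] selfSimilar ω W := by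
  intro hae
  have hU : IsOpen {z : SpaceTime (n + 1) | 0 < z.1 ∧ a * z.1 < z.2 0 ∧ z.2 0 < b * z.1} :=
    (isOpen_lt (by fun_prop) (by fun_prop : Continuous fun z : SpaceTime (n + 1) => z.1)).inter
      ((isOpen_lt (by fun_prop : Continuous fun z : SpaceTime (n + 1) => a * z.1)
        (by fun_prop)).inter (isOpen_lt (by fun_prop)
        (by fun_prop : Continuous fun z : SpaceTime (n + 1) => b * z.1)))
  obtain ⟨x, hx, hx'⟩ := exists_between hab
  have hpos := hU.measure_pos volume ⟨(1, fun _ => x), one_pos, by simpa, by simpa⟩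
  rw [Filter.EventuallyEq, ae_restrict_iff' (measurableSet_future _), ae_iff] at hae
  refine hpos.ne' (measure_mono_null (fun z hz => ?_) hae)
  intro hz'
  have h1 := hz' ⟨hz.1, mem_univ _⟩
  rw [selfSimilar_eq hω, selfSimilar_eq hω] at h1
  exact h _ ⟨(lt_div_iff₀ hz.1).2 hz.2.1, (div_lt_iff₀ hz.1).2 hz.2.2⟩ h1

/-! ### The two solutions of the Riemann problem -/

/-- Separates the sign of the field from its strength; since `q` and `Φ` are odd, the construction
reduces to positive fields. -/
theorem Medium.exists_sign_abs (M : Medium) {d : ℝ} (hd : d ≠ 0) :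
    ∃ κ E : ℝ, κ ^ 2 = 1 ∧ 0 < E ∧ M.q (κ * E) = d := by
  have he : M.p d ≠ 0 := fun h => hd (by rw [← M.q_p d, h]; simp [Medium.q])
  refine ⟨M.p d / |M.p d|, |M.p d|, ?_, abs_pos.2 he, ?_⟩
  · rw [div_pow, sq_abs, div_self (pow_ne_zero 2 he)]
  · rw [div_mul_cancel₀ _ (abs_ne_zero.2 he), M.q_p]

theorem odd_mul_sign {f : ℝ → ℝ} (hf : ∀ x, f (-x) = -f x) {κ : ℝ} (hκ : κ ^ 2 = 1)
    (x : ℝ) : f (κ * x) = κ * f x := by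
  rcases mul_self_eq_one_iff.1 ((sq κ).symm.trans hκ) with rfl | rfl
  · simp
  · simp [hf]

theorem dirFlux_single {n : ℕ} {X Y : Type*} [AddCommGroup Y] [Module ℝ Y]
    {ω : Fin (n + 1) → ℝ} (hω : ω = Pi.single 0 1) (F : Fin (n + 1) → X → Y) (u : X) :
    dirFlux F ω u = F 0 u := by
  rw [dirFlux, Fin.sum_univ_succ]
  simp [hω]

theorem fullRankineHugoniot_state {M : Medium} {τ eL HL eR HR : ℝ}
    (h₁ : τ * (M.q eR - M.q eL) = HR - HL) (h₂ : τ * (HR - HL) = M.μ₀⁻¹ * (eR - eL)) :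
    RankineHugoniot (dirFlux (fullFlux M) ![1, 0, 0]) τ (toFull (M.state eL HL))
      (toFull (M.state eR HR)) := by
  rw [RankineHugoniot, dirFlux_single vec_three_eq, dirFlux_single vec_three_eq,
    M.fullFlux_zero_state, M.fullFlux_zero_state]
  simp only [toFull, Medium.state]
  ext i <;> fin_cases i <;> simp [h₁, h₂, mul_sub]

theorem Medium.lamMax_state (M : Medium) (e H : ℝ) :
    M.lamMax (toFull (M.state e H)).1 = M.c / √(1 + M.εr * e ^ 2) := by
  simp [Medium.lamMax, toFull, Medium.state, M.eField_three, eLen_three]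

theorem RankineHugoniot.refl {X : Type*} [AddCommGroup X] [Module ℝ X] (F : X → X) (σ : ℝ)
    (u : X) : RankineHugoniot F σ u u := by simp [RankineHugoniot]

/-- A `6`-contact is a Lax solution of the full system. -/
theorem isLaxSolution_of_contact {M : Medium} {ω : Fin 3 → ℝ} {σ : ℝ} {ul ur : FullState}
    (hσ : 0 < σ) (h : IsFullContact M ω 6 σ ul ur) {V : ℝ → FullState}
    (hl : ∀ ξ < σ, V ξ = ul) (hr : ∀ ξ, σ < ξ → V ξ = ur) : IsLaxSolution M ω ul ur V := by
  have hlam : M.lamMax ul.1 = σ := h.2.1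
  -- All intermediate states are `ul`. Even a trivial 1-contact must travel at its characteristic
  -- speed, hence `-σ`; the trivial 2- and 5-waves are placed at `0`.
  refine ⟨ul, ul, ul, ul, -σ, 0, 0, 0, 0, σ, by linarith, le_rfl, le_rfl, le_rfl, le_rfl, hσ.le,
    fun ξ hξ => hl ξ (by linarith), ⟨.refl _ _ _, ?_, ?_⟩, fun ξ hξ => hl ξ (by linarith [hξ.2]),
    Or.inl ⟨rfl, rfl⟩, fun ξ hξ => hl ξ (by linarith [hξ.2]), ⟨.refl _ _ _, rfl, rfl⟩,
    fun ξ hξ => hl ξ (by linarith [hξ.2]), Or.inl ⟨rfl, rfl⟩, fun ξ hξ => hl ξ hξ.2, h, hr⟩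
  · simp [fullEig, hlam]
  · simp [fullEig, hlam]

end Kerr

end

/-! ### The two entropy solutions -/

theorem mainTheorem4 (M : Kerr.Medium) (d h σ : ℝ) (hd : d ≠ 0)
    (uL uR : Kerr.TMState)
    (huL : uL = (![0, d], h))
    (hσ : σ = M.c / √(1 + M.εr * Kerr.eLen (M.eField uL.1) ^ 2))
    (huR : uR = (![0, -d], h + σ * (-d - d))) :
    -- the data are a nontrivial contact discontinuity of the full system for the field 6
    Kerr.IsFullContact M ![1, 0, 0] 6 σ (Kerr.toFull uL) (Kerr.toFull uR) ∧ uL ≠ uR ∧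
    ∃ V W : ℝ → Kerr.TMState,
      -- `V` is the contact discontinuity, a Lax solution of the full system
      (∀ ξ < σ, V ξ = uL) ∧ (∀ ξ, σ < ξ → V ξ = uR) ∧
      Kerr.IsLaxSolution M ![1, 0, 0] (Kerr.toFull uL) (Kerr.toFull uR)
        (fun ξ => Kerr.toFull (V ξ)) ∧
      -- `V` gives an entropy solution of the TM system and conserves energy
      Kerr.IsEntropySolution (Kerr.tmFlux M) (Kerr.tmEnergy M) (Kerr.tmEnergyFlux M)
        (Kerr.riemannData ![1, 0] uL uR) (Kerr.selfSimilar ![1, 0] V) ∧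
      Kerr.ConservesEntropy (Kerr.tmEnergy M) (Kerr.tmEnergyFlux M)
        (Kerr.riemannData ![1, 0] uL uR) (Kerr.selfSimilar ![1, 0] V) ∧
      -- `W` is Liu's solution, and gives an entropy solution of the TM system
      Kerr.IsLiuSolution M ![1, 0] uL uR W ∧
      Kerr.IsEntropySolution (Kerr.tmFlux M) (Kerr.tmEnergy M) (Kerr.tmEnergyFlux M)
        (Kerr.riemannData ![1, 0] uL uR) (Kerr.selfSimilar ![1, 0] W) ∧
      ¬ Kerr.ConservesEntropy (Kerr.tmEnergy M) (Kerr.tmEnergyFlux M)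
        (Kerr.riemannData ![1, 0] uL uR) (Kerr.selfSimilar ![1, 0] W) ∧
      -- `W` is a 1-rarefaction followed by a composite 3-wave (a rarefaction and a shock),
      -- and its energy is dissipated by the shock, at the rate given by the jump
      (∃ (u₁ v : Kerr.TMState) (a₁ b₁ a₃ s : ℝ), b₁ < 0 ∧ 0 < a₃ ∧
        (∀ ξ < a₁, W ξ = uL) ∧
        Kerr.IsRarefaction (Kerr.dirFlux (Kerr.tmFlux M) ![1, 0]) (Kerr.tmEig M ![1, 0] 1)
          W a₁ b₁ uL u₁ ∧
        (∀ ξ ∈ Set.Icc b₁ a₃, W ξ = u₁) ∧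
        Kerr.IsComposite₃ M ![1, 0] W a₃ s u₁ v uR ∧
        (∀ ξ, s < ξ → W ξ = uR) ∧
        Kerr.entropyJump (Kerr.tmEnergy M) (Kerr.dirFlux (Kerr.tmEnergyFlux M) ![1, 0])
          s v uR < 0 ∧
        ∀ φ : Kerr.SpaceTime 2 → ℝ, Kerr.IsTest φ →
          Kerr.entropyForm (Kerr.tmEnergy M) (Kerr.tmEnergyFlux M)
              (Kerr.riemannData ![1, 0] uL uR) (Kerr.selfSimilar ![1, 0] W) φ =
            -Kerr.entropyJump (Kerr.tmEnergy M)
                (Kerr.dirFlux (Kerr.tmEnergyFlux M) ![1, 0]) s v uR *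
              ∫ z in Set.Ioi (0 : ℝ) ×ˢ (Set.univ : Set ℝ), φ (z.1, ![s * z.1, z.2])) ∧
      -- the two solutions are distinct
      ¬ (Kerr.selfSimilar ![1, 0] V
          =ᵐ[MeasureTheory.volume.restrict (Kerr.future 2)] Kerr.selfSimilar ![1, 0] W) ∧
      -- both are, as TM fields, entropy solutions of the full system as well
      Kerr.IsEntropySolution (Kerr.fullFlux M) (Kerr.fullEnergy M) (Kerr.fullEnergyFlux M)
        (Kerr.riemannData ![1, 0, 0] (Kerr.toFull uL) (Kerr.toFull uR))
        (Kerr.selfSimilar ![1, 0, 0] (fun ξ => Kerr.toFull (V ξ))) ∧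
      Kerr.IsEntropySolution (Kerr.fullFlux M) (Kerr.fullEnergy M) (Kerr.fullEnergyFlux M)
        (Kerr.riemannData ![1, 0, 0] (Kerr.toFull uL) (Kerr.toFull uR))
        (Kerr.selfSimilar ![1, 0, 0] (fun ξ => Kerr.toFull (W ξ))) := by
  obtain ⟨κ, E, hκ, hE, rfl⟩ := M.exists_sign_abs hd
  have hκ0 : κ ≠ 0 := fun h => by simp [h] at hκ
  have hε := M.ε₀_pos
  have hεr := M.εr_pos
  replace huL : uL = M.state (κ * E) h := huL
  have hσ' : σ = M.c / √(1 + M.εr * E ^ 2) := by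
    rw [hσ, huL, Kerr.Medium.state, M.eField_two, Kerr.Medium.eLen_two, sq_abs, mul_pow, hκ, one_mul]
  have hA := M.one_add_sq_pos E
  have hσ0 : 0 < σ := hσ' ▸ div_pos M.c_pos (Real.sqrt_pos.2 hA)
  have hqκ := Kerr.odd_mul_sign M.q_neg hκ
  have hφκ := Kerr.odd_mul_sign M.phi_neg hκ
  set HR := h + σ * (-M.q (κ * E) - M.q (κ * E)) with hHR
  replace huR : uR = M.state (-(κ * E)) HR := by rw [huR, Kerr.Medium.state, M.q_neg]
  -- the contact discontinuity
  have hc₁ : σ * (M.q (-(κ * E)) - M.q (κ * E)) = HR - h := by rw [M.q_neg, hHR]; ring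
  have hc₂ : σ * (HR - h) = M.μ₀⁻¹ * (-(κ * E) - κ * E) := by
    have hσ2 : σ ^ 2 * (1 + M.εr * E ^ 2) = M.c ^ 2 := by
      rw [hσ', div_pow, Real.sq_sqrt hA.le]; field_simp
    rw [← hc₁, M.q_neg, hqκ, M.q_eq, ← M.c_sq_mul]
    linear_combination (-2 * κ * M.ε₀ * E) * hσ2
  have hm₀ : -σ * (M.energy (-(κ * E)) HR - M.energy (κ * E) h) +
      (HR * -(κ * E) - h * (κ * E)) = 0 := by
    rw [Kerr.energy_production hc₁ hc₂]; ring
  have hV := Kerr.TMBalance.shock hc₁ hc₂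
  rw [hm₀] at hV
  have hcontact : Kerr.IsFullContact M ![1, 0, 0] 6 σ (Kerr.toFull uL) (Kerr.toFull uR) := by
    subst huL huR
    refine ⟨Kerr.fullRankineHugoniot_state hc₁ hc₂, ?_, ?_⟩
    · rw [Kerr.fullEig, M.lamMax_state, mul_pow, hκ, one_mul, hσ']
    · rw [Kerr.fullEig, M.lamMax_state, neg_sq, mul_pow, hκ, one_mul, hσ']
  -- the intermediate states
  obtain ⟨E₁, hEE₁, hE₁⟩ := M.exists_middle_field hE
  rw [← hσ'] at hE₁
  have hE₁0 : 0 < E₁ := hE.trans hEE₁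
  have hE2 : 0 < E / 2 := half_pos hE
  set s := M.speed (E / 2) with hs
  have hs0 : 0 < s := M.speed_pos _
  have hsc : s < M.c := M.speed_lt_c hE2.ne'
  have h₁ : M.speed E₁ < M.speed E := M.speed_lt_speed (by gcongr)
  have h₃ : M.speed E₁ < s := M.speed_lt_speed (by gcongr; linarith)
  have h₁0 : 0 < M.speed E₁ := M.speed_pos _
  -- Riemann invariants: `H + Φ = C₁` along the 1-rarefaction and `H - Φ = C₃` along the
  -- 3-rarefaction. Continuity at the middle field `κ E₁` forces `C₃ = C₁ - 2 Φ(κ E₁)`.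
  set C₁ := h + M.phi (κ * E) with hC₁
  set C₃ := C₁ - 2 * M.phi (κ * E₁) with hC₃
  have hw₁ := M.simpleWave hκ (τ := -1) (by norm_num) C₁ (a := -M.speed E) (b := -M.speed E₁)
    fun ξ hξ => ⟨by linarith [hξ.2], by linarith [hξ.1, M.speed_lt_c hE.ne']⟩
  have hw₃ := M.simpleWave hκ (τ := 1) (by norm_num) C₃ (a := M.speed E₁) (b := s)
    fun ξ hξ => ⟨by linarith [hξ.1], by linarith [hξ.2]⟩
  have hfE : M.fieldAt (-M.speed E) = E := by rw [M.fieldAt_neg, M.fieldAt_speed hE.le]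
  have hfE₁ : M.fieldAt (-M.speed E₁) = E₁ := by rw [M.fieldAt_neg, M.fieldAt_speed hE₁0.le]
  have hfE₁' : M.fieldAt (M.speed E₁) = E₁ := M.fieldAt_speed hE₁0.le
  have hfs : M.fieldAt s = E / 2 := M.fieldAt_speed hE2.le
  set Hv := C₃ + M.phi (κ * (E / 2)) with hHv
  -- The equation defining `E₁` is exactly the first jump relation for the shock.
  have hs₁ : s * (M.q (-(κ * E)) - M.q (κ * (E / 2))) = HR - Hv := by
    rw [hHR, hHv, hC₃, hC₁, M.q_neg, hqκ, hqκ, hφκ, hφκ, hφκ]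
    linear_combination (-κ) * hE₁
  -- The second jump relation is the tangency of the chord at `E / 2`, where `s` is characteristic.
  have hs₂ : s * (HR - Hv) = M.μ₀⁻¹ * (-(κ * E) - κ * (E / 2)) := by
    have := M.speed_sq_mul (E / 2)
    rw [← hs₁, M.q_neg, hqκ, hqκ, ← this]
    unfold Kerr.Medium.q
    ring
  have hm : -s * (M.energy (-(κ * E)) HR - M.energy (κ * (E / 2)) Hv) +
      (HR * -(κ * E) - Hv * (κ * (E / 2))) < 0 := by
    rw [Kerr.energy_production hs₁ hs₂]
    -- `27 / 16 = (1 - 1 / 4) (3 / 2)²`, from the fields `E / 2` and `-E`.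
    have : M.ε₀ * M.εr / 4 * ((-(κ * E)) ^ 2 - (κ * (E / 2)) ^ 2) *
        (-(κ * E) - κ * (E / 2)) ^ 2 = M.ε₀ * M.εr / 4 * (27 / 16 * E ^ 4) := by
      linear_combination (M.ε₀ * M.εr / 4 * (27 / 16 * E ^ 4)) * (κ ^ 2 + 1) * hκ
    rw [this, neg_mul]
    exact neg_neg_of_pos (by positivity)
  have hW := Kerr.TMBalance.profile hw₁ hw₃ (eR := -(κ * E)) (HR := HR) (neg_le_neg h₁.le)
    (by linarith) h₃.le (by rw [hfE₁, hfE₁']) (by rw [hfE₁, hfE₁', hC₃]; ring)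
    (by rw [hfs, one_mul]; exact hs₁) (by rw [hfs, one_mul]; exact hs₂)
  simp only [hfE, hfs] at hW
  rw [show C₁ + -1 * M.phi (κ * E) = h by rw [hC₁]; ring, one_mul, ← hHv] at hW
  have ha₁b₁ : -M.speed E < -M.speed E₁ := neg_lt_neg h₁
  have hb₁a₃ : -M.speed E₁ ≤ M.speed E₁ := by linarith
  set p₁ : ℝ → Kerr.TMState := fun ξ =>
    M.state (κ * M.fieldAt ξ) (C₁ + -1 * M.phi (κ * M.fieldAt ξ)) with hp₁
  set p₃ : ℝ → Kerr.TMState := fun ξ =>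
    M.state (κ * M.fieldAt ξ) (C₃ + 1 * M.phi (κ * M.fieldAt ξ)) with hp₃
  have hpa : p₁ (-M.speed E) = uL := by
    rw [huL, hp₁]; simp only [hfE]; congr 1; rw [hC₁]; ring
  have hpb : p₁ (-M.speed E₁) = p₃ (M.speed E₁) := by
    simp only [hp₁, hp₃, hfE₁, hfE₁']; congr 1; rw [hC₃]; ring
  have hps : p₃ s = M.state (κ * (E / 2)) Hv := by
    simp only [hp₃, hfs, one_mul]; rfl
  set V : ℝ → Kerr.TMState := fun ξ =>
    M.state (if σ < ξ then -(κ * E) else κ * E) (if σ < ξ then HR else h) with hVdef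
  obtain ⟨W, hWdef⟩ : ∃ W : ℝ → Kerr.TMState, W = fun ξ => M.state
    (Kerr.profile (-M.speed E) (-M.speed E₁) (M.speed E₁) s (fun ξ => κ * M.fieldAt ξ)
      (fun ξ => κ * M.fieldAt ξ) (-(κ * E)) ξ)
    (Kerr.profile (-M.speed E) (-M.speed E₁) (M.speed E₁) s
      (fun ξ => C₁ + -1 * M.phi (κ * M.fieldAt ξ)) (fun ξ => C₃ + 1 * M.phi (κ * M.fieldAt ξ))
      HR ξ) := ⟨_, rfl⟩
  have hWp : ∀ ξ, W ξ =
      Kerr.profile (-M.speed E) (-M.speed E₁) (M.speed E₁) s p₁ p₃ uR ξ := fun ξ => by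
    rw [hWdef, huR]
    exact Kerr.apply_profile₂ M.state _ _ _ _ _ _ _ _ _ _ _
  have hV₁ : ∀ ξ ≤ σ, V ξ = uL := fun ξ hξ => by
    simp only [hVdef, if_neg hξ.not_gt, huL]
  have hV₂ : ∀ ξ, σ < ξ → V ξ = uR := fun ξ hξ => by
    simp only [hVdef, if_pos hξ, huR]
  have hW₁ : ∀ ξ ≤ -M.speed E, W ξ = uL := fun ξ hξ => by
    rw [hWp, Kerr.profile_of_le ha₁b₁.le hb₁a₃ hξ, hpa]
  have hW₂ : ∀ ξ ∈ Set.Icc (-M.speed E₁) (M.speed E₁), W ξ = p₁ (-M.speed E₁) := fun ξ hξ => by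
    rw [hWp, Kerr.profile_of_mem_middle ha₁b₁.le hξ]
  have hW₃ : ∀ ξ, s < ξ → W ξ = uR := fun ξ hξ => by
    rw [hWp, Kerr.profile_of_lt h₃.le hξ]
  have hr₁ : Kerr.IsRarefaction (Kerr.dirFlux (Kerr.tmFlux M) ![1, 0]) (Kerr.tmEig M ![1, 0] 1)
      W (-M.speed E) (-M.speed E₁) uL (p₁ (-M.speed E₁)) := by
    rw [← hpa]
    refine hw₁.isRarefaction ha₁b₁ (fun ξ hξ => ?_) (fun ξ hξ => ?_)
    · rw [hWp, Kerr.profile_of_mem_left hb₁a₃ hξ]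
    · have hξ0 : ξ < 0 := by linarith [hξ.2]
      rw [Kerr.tmEig, M.lam_two, M.speed_mul_fieldAt hκ hξ0.ne, abs_of_neg hξ0, neg_neg]
      rw [abs_of_neg hξ0]
      linarith [hξ.1, M.speed_lt_c hE.ne']
  have hr₃ : Kerr.IsRarefaction (Kerr.dirFlux (Kerr.tmFlux M) ![1, 0]) (Kerr.tmEig M ![1, 0] 3)
      W (M.speed E₁) s (p₁ (-M.speed E₁)) (M.state (κ * (E / 2)) Hv) := by
    rw [hpb, ← hps]
    refine hw₃.isRarefaction h₃ (fun ξ hξ => ?_) (fun ξ hξ => ?_)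
    · rw [hWp, Kerr.profile_of_mem_right ha₁b₁.le hb₁a₃ hpb hξ]
    · have hξ0 : 0 < ξ := by linarith [hξ.1]
      rw [Kerr.tmEig, M.lam_two, M.speed_mul_fieldAt hκ hξ0.ne', abs_of_pos hξ0]
      rw [abs_of_pos hξ0]
      linarith [hξ.2]
  have hqE : 0 < M.q E := by rw [M.q_eq]; positivity
  have hqE2 : 0 < M.q (E / 2) := by
    have := M.one_add_sq_pos (E / 2)
    rw [M.q_eq]; positivity
  have hopp : M.q (κ * (E / 2)) * M.q (-(κ * E)) < 0 := by
    rw [M.q_neg, hqκ, hqκ, show κ * M.q (E / 2) * -(κ * M.q E) =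
      -(κ ^ 2 * (M.q (E / 2) * M.q E)) by ring, hκ, one_mul]
    exact neg_neg_of_pos (mul_pos hqE2 hqE)
  have hne : M.state (κ * (E / 2)) Hv ≠ uR := fun hh => by
    have h1 : M.q (κ * (E / 2)) = M.q (-(κ * E)) := by
      rw [huR] at hh
      exact congrFun (congrArg Prod.fst hh) 1
    rw [h1] at hopp
    exact (mul_self_nonneg _).not_gt hopp
  have hcomp : Kerr.IsComposite₃ M ![1, 0] W (M.speed E₁) s (p₁ (-M.speed E₁))
      (M.state (κ * (E / 2)) Hv) uR := by
    refine ⟨hr₃, ?_, hs0, hne, ?_⟩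
    · rw [huR]; simpa [Kerr.cross2, Kerr.Medium.state] using hopp
    · rw [huR]; exact Kerr.isLiuAdmissible_of_half hκ hE hs₁ hs₂
  have hjump : Kerr.entropyJump (Kerr.tmEnergy M) (Kerr.dirFlux (Kerr.tmEnergyFlux M) ![1, 0])
      s (M.state (κ * (E / 2)) Hv) uR =
      -s * (M.energy (-(κ * E)) HR - M.energy (κ * (E / 2)) Hv) +
      (HR * -(κ * E) - Hv * (κ * (E / 2))) := by
    rw [huR, Kerr.entropyJump, M.tmEnergy_state, M.tmEnergy_state,
      Kerr.dirFlux_single Kerr.vec_two_eq, Kerr.dirFlux_single Kerr.vec_two_eq]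
    simp [Kerr.tmEnergyFlux, Kerr.Medium.state, M.eField_two]
  have hform : ∀ φ : Kerr.SpaceTime 2 → ℝ, Kerr.IsTest φ →
      Kerr.entropyForm (Kerr.tmEnergy M) (Kerr.tmEnergyFlux M)
        (Kerr.riemannData ![1, 0] uL uR) (Kerr.selfSimilar ![1, 0] W) φ =
      -Kerr.entropyJump (Kerr.tmEnergy M) (Kerr.dirFlux (Kerr.tmEnergyFlux M) ![1, 0])
        s (M.state (κ * (E / 2)) Hv) uR * Kerr.planeIntegral s φ := fun φ hφ => by
    rw [hjump, hWdef, huL, huR]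
    exact hW.tm_entropyForm hφ
  have hne' : uL ≠ uR := fun hh => by
    have h1 : M.q (κ * E) = M.q (-(κ * E)) := by
      rw [huL, huR] at hh
      exact congrFun (congrArg Prod.fst hh) 1
    rw [M.q_neg, hqκ] at h1
    have : κ * M.q E ≠ 0 := mul_ne_zero hκ0 hqE.ne'
    exact this (by linarith)
  have hmid : uL ≠ p₁ (-M.speed E₁) := fun hh => by
    have h1 : M.q (κ * E) = M.q (κ * E₁) := by
      rw [huL] at hh
      have := congrFun (congrArg Prod.fst hh) 1
      simp only [hp₁, hfE₁] at this
      exact this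
    have h2 := mul_left_cancel₀ hκ0 (M.q_strictMono.injective h1)
    exact hEE₁.ne h2
  refine ⟨hcontact, hne', V, W, fun ξ hξ => hV₁ ξ hξ.le, hV₂,
    Kerr.isLaxSolution_of_contact hσ0 hcontact (fun ξ hξ => by rw [hV₁ ξ hξ.le])
      (fun ξ hξ => by rw [hV₂ ξ hξ]), ?_, fun φ hφ => ?_, ?_, ?_, fun hcons => ?_, ?_, ?_, ?_, ?_⟩
  · rw [huL, huR]; exact hV.tm_isEntropySolution le_rfl
  · rw [huL, huR]; exact (hV.tm_entropyForm hφ).trans (by simp)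
  · exact ⟨p₁ (-M.speed E₁), p₁ (-M.speed E₁), -M.speed E, -M.speed E₁, M.speed E₁, s,
      ha₁b₁.le, by linarith, h₁0.le, h₃.le, fun ξ hξ => hW₁ ξ hξ.le, Or.inr (Or.inr (Or.inl hr₁)),
      fun ξ hξ => hW₂ ξ ⟨hξ.1.le, by linarith [hξ.2]⟩, ⟨.refl _ _ _, rfl, rfl⟩,
      fun ξ hξ => hW₂ ξ ⟨by linarith [hξ.1], hξ.2.le⟩, Or.inr (Or.inr (Or.inr ⟨_, hcomp⟩)), hW₃⟩
  · rw [hWdef, huL, huR]; exact hW.tm_isEntropySolution hm.le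
  · obtain ⟨φ, hφ, hpos⟩ := Kerr.exists_planeIntegral_pos s
    have h0 := (hform φ hφ).symm.trans (hcons φ hφ)
    rw [hjump] at h0
    exact (mul_pos (neg_pos.2 hm) hpos).ne' h0
  · exact ⟨p₁ (-M.speed E₁), M.state (κ * (E / 2)) Hv, -M.speed E, -M.speed E₁, M.speed E₁, s,
      by linarith, h₁0, fun ξ hξ => hW₁ ξ hξ.le, hr₁, hW₂, hcomp, hW₃, hjump ▸ hm,
      fun φ hφ => by rw [hform φ hφ, Kerr.planeIntegral_eq hφ]⟩
  -- On this range `V` is still `uL`, while `W` has reached the middle state, whose field is the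
  -- stronger `E₁ > E`.
  · refine Kerr.not_ae_eq_selfSimilar (a := -M.speed E₁) (b := 0) (by linarith)
      (fun ξ hξ => ?_) Kerr.vec_two_eq
    rw [hV₁ ξ (by linarith [hξ.2]), hW₂ ξ ⟨hξ.1.le, by linarith [hξ.2]⟩]
    exact hmid
  · rw [huL, huR]; exact hV.full_isEntropySolution le_rfl
  · rw [hWdef, huL, huR]; exact hW.full_isEntropySolution hm.le
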